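/- Let $p$ be a prime number and let $\mathbf{B}=\{0,1\}$ be the Boolean semiring ($1+1=1$). All semirings are commutative. Let $\Lambda_{\mathbf N}=\bigoplus_\lambda \mathbf{N}\,m_\lambda$ be the semiring of symmetric functions in $x_1,x_2,\dots$ with coefficients in $\mathbf N=\{0,1,2,\dots\}$, where $\lambda=(\lambda_1\ge\lambda_2\ge\cdots)$ runs over all partitions and $m_\lambda$ is the monomial symmetric function. Put $\psi=\sum_i x_i^p$, $d=\frac1p\big((\sum_i x_i)^p-\sum_i x_i^p\big)$ and $d_{i,j}=d^{\circ i}\circ\psi^{\circ j}$ for $i,j\in\mathbf N$, where $\circ$ is plethysm, and let $\Lambda_{\mathbf N,(p)}\subseteq\Lambda_{\mathbf N}$ be the subsemiring generated by all the $d_{i,j}$. Let $W(\mathbf B)$ be the set of semiring homomorphisms $\Lambda_{\mathbf N}\to\mathbf B$, let $W_{(p)}(\mathbf B)$ be the set of semiring homomorphisms $\Lambda_{\mathbf N,(p)}\to\mathbf B$, and let the canonical map $W(\mathbf B)\to W_{(p)}(\mathbf B)$ be restriction to $\Lambda_{\mathbf N,(p)}$. There is a bijection $\mathbf N^2\cup\{\infty\}\to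 W(\mathbf B)$ which sends $(x,y)$ to the homomorphism with $m_\lambda\mapsto 0$ if $\lambda_{x+1}\ge y+1$ and $m_\lambda\mapsto1$ otherwise, and which sends $\infty$ to the homomorphism with $m_\lambda\mapsto 1$ for all $\lambda$. There is also a bijection $\mathbf N^2\cup\{\infty\}\to W_{(p)}(\mathbf B)$ which sends $(x,y)$ to the homomorphism with $d_{i,j}\mapsto 0$ if $i\ge x$ and $j\ge y$, and $d_{i,j}\mapsto 1$ otherwise, and which sends $\infty$ to the homomorphism with $d_{i,j}\mapsto1$ for all $i,j$. In terms of these two bijections, the canonical map $W(\mathbf B)\to W_{(p)}(\mathbf B)$ is as follows. If $x\le 1$, or if $p=2$ and $x\le 2$, then $(x,y)\in\mathbf N^2$ is sent to $(x,z)$, where $z$ is the least element of $\mathbf N$ with $p^z>y$. All other elements of $\mathbf N^2\cup\{\infty\}$ are sent to $\infty$. -/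

import Mathlib

namespace BooleanWitt

/-! The Boolean semiring. -/

/-- The Boolean semiring `{0, 1}` with `1 + 1 = 1`. -/
inductive BoolSemiring : Type
  | zero : BoolSemiring
  | one : BoolSemiring

namespace BoolSemiring

def add : BoolSemiring → BoolSemiring → BoolSemiring
  | zero, b => b
  | one, _ => one

def mul : BoolSemiring → BoolSemiring → BoolSemiring
  | zero, _ => zero
  | one, b => b

instance : Zero BoolSemiring := ⟨zero⟩
instance : One BoolSemiring := ⟨one⟩
instance : Add BoolSemiring := ⟨add⟩
instance : Mul BoolSemiring := ⟨mul⟩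

instance : CommSemiring BoolSemiring where
  add_assoc a b c := by cases a <;> cases b <;> cases c <;> rfl
  zero_add a := by cases a <;> rfl
  add_zero a := by cases a <;> rfl
  add_comm a b := by cases a <;> cases b <;> rfl
  mul_assoc a b c := by cases a <;> cases b <;> cases c <;> rfl
  one_mul a := by cases a <;> rfl
  mul_one a := by cases a <;> rfl
  mul_comm a b := by cases a <;> cases b <;> rfl
  left_distrib a b c := by cases a <;> cases b <;> cases c <;> rfl
  right_distrib a b c := by cases a <;> cases b <;> cases c <;> rfl
  zero_mul a := by cases a <;> rfl
  mul_zero a := by cases a <;> rfl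
  nsmul := nsmulRec
  npow := npowRec

end BoolSemiring

/-! Symmetric functions with coefficients in `ℕ`, in the variables `x₀, x₁, x₂, …`. -/

/-- The semiring `Λ_ℕ`: formal series in `x₀, x₁, …` with coefficients in `ℕ` which are
symmetric and of bounded degree. -/
noncomputable def SymmFunc : Subsemiring (MvPowerSeries ℕ ℕ) where
  carrier := {f | (∀ (σ : Equiv.Perm ℕ) (c : ℕ →₀ ℕ),
      MvPowerSeries.coeff (c.mapDomain σ) f = MvPowerSeries.coeff c f) ∧
    ∃ N : ℕ, ∀ c : ℕ →₀ ℕ, MvPowerSeries.coeff c f ≠ 0 → c.degree ≤ N}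
  zero_mem' := ⟨fun _ _ => by simp, 0, fun c h => by simp at h⟩
  one_mem' := by
    classical
    refine ⟨fun σ c => ?_, 0, fun c h => ?_⟩
    · have : c.mapDomain σ = 0 ↔ c = 0 := by
        rw [← Finsupp.mapDomain_zero (f := σ)]
        exact (Finsupp.mapDomain_injective σ.injective).eq_iff
      simp [MvPowerSeries.coeff_one, this]
    · rw [MvPowerSeries.coeff_one] at h
      have : c = 0 := by by_contra h0; simp [h0] at h
      simp [this]
  add_mem' := by
    rintro f g ⟨hf, N, hN⟩ ⟨hg, M, hM⟩
    refine ⟨fun σ c => by simp [hf σ c, hg σ c], max N M, fun c h => ?_⟩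
    rw [map_add] at h
    by_cases h1 : MvPowerSeries.coeff c f = 0
    · exact le_max_of_le_right (hM c (by simpa [h1] using h))
    · exact le_max_of_le_left (hN c h1)
  mul_mem' := by
    classical
    rintro f g ⟨hf, N, hN⟩ ⟨hg, M, hM⟩
    refine ⟨fun σ c => ?_, N + M, fun c h => ?_⟩
    · have key : ∀ k : MvPowerSeries ℕ ℕ,
          (∀ c : ℕ →₀ ℕ, MvPowerSeries.coeff (c.mapDomain σ) k = MvPowerSeries.coeff c k) →
          MvPowerSeries.rename σ.toEmbedding k = k := by
        intro k hk
        ext e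
        have he : e = Finsupp.embDomain σ.toEmbedding (e.mapDomain σ.symm) := by
          rw [Finsupp.embDomain_eq_mapDomain]
          change e = Finsupp.mapDomain σ (e.mapDomain σ.symm)
          rw [← Finsupp.mapDomain_comp]
          simp
        conv_lhs => rw [he]
        rw [MvPowerSeries.coeff_embDomain_rename, ← hk, ← Finsupp.mapDomain_comp]
        simp
      have h := MvPowerSeries.coeff_embDomain_rename σ.toEmbedding (f * g) c
      rw [map_mul, key f (hf σ), key g (hg σ), Finsupp.embDomain_eq_mapDomain] at h
      exact h
    · rw [MvPowerSeries.coeff_mul] at h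
      obtain ⟨⟨a, b⟩, hab, hne⟩ := Finset.exists_ne_zero_of_sum_ne_zero h
      rw [Finset.HasAntidiagonal.mem_antidiagonal] at hab
      have h1 := hN a (left_ne_zero_of_mul hne)
      have h2 := hM b (right_ne_zero_of_mul hne)
      rw [← hab]
      simp only [map_add]
      exact add_le_add h1 h2

/-- Partitions `λ₁ ≥ λ₂ ≥ ⋯`, as weakly decreasing finitely supported sequences. The part
`λ_{i+1}` is `l.1 i`. -/
def Part : Type := {l : ℕ →₀ ℕ // Antitone l}

/-- The monomial symmetric function `m_λ`: the sum of all distinct monomials whose exponent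
sequence is a rearrangement of `λ`. -/
noncomputable def monomialSymm (l : Part) : SymmFunc := by
  classical
  exact ⟨fun c => if ∃ σ : Equiv.Perm ℕ, l.1.mapDomain σ = c then 1 else 0, by
    refine ⟨fun τ c => ?_, l.1.degree, fun c h => ?_⟩
    · have : (∃ σ : Equiv.Perm ℕ, l.1.mapDomain σ = c.mapDomain τ) ↔
          ∃ σ : Equiv.Perm ℕ, l.1.mapDomain σ = c := by
        constructor
        · rintro ⟨σ, hσ⟩
          refine ⟨σ.trans τ.symm, ?_⟩
          rw [Equiv.coe_trans, Finsupp.mapDomain_comp, hσ, ← Finsupp.mapDomain_comp]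
          simp
        · rintro ⟨σ, rfl⟩
          exact ⟨σ.trans τ, by rw [Equiv.coe_trans, Finsupp.mapDomain_comp]⟩
      change (if _ then 1 else 0) = (if _ then 1 else 0)
      simp only [this]
    · change (if _ then 1 else 0) ≠ 0 at h
      have h' : ∃ σ : Equiv.Perm ℕ, l.1.mapDomain σ = c := by
        by_contra h0
        simp [h0] at h
      obtain ⟨σ, rfl⟩ := h'
      simp⟩

/-- The power sum `ψ_n = ∑ᵢ xᵢⁿ` (for `n ≥ 1`). -/
noncomputable def powerSum (n : ℕ) : SymmFunc := by
  classical
  exact ⟨fun c => if ∃ i : ℕ, c = Finsupp.single i n then 1 else 0, by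
    refine ⟨fun τ c => ?_, n, fun c h => ?_⟩
    · have : (∃ i : ℕ, c.mapDomain τ = Finsupp.single i n) ↔
          ∃ i : ℕ, c = Finsupp.single i n := by
        constructor
        · rintro ⟨i, hi⟩
          refine ⟨τ.symm i, Finsupp.mapDomain_injective τ.injective ?_⟩
          simp [hi]
        · rintro ⟨i, rfl⟩
          exact ⟨τ i, by simp⟩
      change (if _ then 1 else 0) = (if _ then 1 else 0)
      simp only [this]
    · change (if _ then 1 else 0) ≠ 0 at h
      have h' : ∃ i : ℕ, c = Finsupp.single i n := by
        by_contra h0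
        simp [h0] at h
      obtain ⟨i, rfl⟩ := h'
      simp⟩

/-! Plethysm. Write `g = ∑_{(e, k)} x^e`, the sum being over the pairs `(e, k)` with `e` an
exponent and `k < g_e`, where `g_e` is the coefficient of `x^e` in `g`. Then `f ∘ g` is obtained
by substituting the monomials `x^e` (with these multiplicities) for the variables of `f`. -/

/-- An enumeration of the pairs `(e, k)`; `f ∘ g` does not depend on it as `f` is symmetric. -/
noncomputable def enum : (ℕ →₀ ℕ) × ℕ ≃ ℕ :=
  Classical.choice nonempty_equiv_of_countable

/-- The exponents `α`, in variables indexed by the pairs `(e, k)` with `k < g_e`, such that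
substituting `x^e` for the variable `(e, k)` turns the monomial with exponent `α` into `x^c`. -/
def plethysmIndex (g : MvPowerSeries ℕ ℕ) (c : ℕ →₀ ℕ) : Set (((ℕ →₀ ℕ) × ℕ) →₀ ℕ) :=
  {α | (∀ q ∈ α.support, q.2 < MvPowerSeries.coeff q.1 g) ∧ α.sum (fun q m => m • q.1) = c}

/-- The coefficient of `x^c` in the plethysm `f ∘ g`. For `f, g` in `Λ_ℕ` the sum has only
finitely many nonzero terms. -/
noncomputable def plethysmCoeff (f g : MvPowerSeries ℕ ℕ) (c : ℕ →₀ ℕ) : ℕ :=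
  ∑ᶠ α ∈ plethysmIndex g c, MvPowerSeries.coeff (α.mapDomain enum) f

theorem plethysmCoeff_finite (f g : SymmFunc) (c : ℕ →₀ ℕ) :
    {α ∈ plethysmIndex g.1 c | MvPowerSeries.coeff (α.mapDomain enum) f.1 ≠ 0}.Finite := by
  classical
  obtain ⟨N, hN⟩ := f.2.2
  let S : Finset ((ℕ →₀ ℕ) × ℕ) :=
    (Finset.Iic c).biUnion fun e => (Finset.range (MvPowerSeries.coeff e g.1)).image (Prod.mk e)
  refine ((Finset.finsupp S fun _ => Finset.range (N + 1)).finite_toSet).subset ?_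
  rintro α ⟨⟨h1, h2⟩, h3⟩
  have hdeg : α.degree ≤ N := by simpa using hN _ h3
  rw [Finset.mem_coe, Finset.mem_finsupp_iff]
  refine ⟨fun q hq => ?_, fun q _ => ?_⟩
  · have hle : q.1 ≤ c := by
      have hs : α q • q.1 ≤ α.sum (fun q m => m • q.1) :=
        Finset.single_le_sum (f := fun q => α q • q.1) (fun _ _ => zero_le) hq
      rw [h2] at hs
      refine le_trans ?_ hs
      have : 1 ≤ α q := Nat.one_le_iff_ne_zero.mpr (Finsupp.mem_support_iff.mp hq)
      intro i
      simpa using Nat.le_mul_of_pos_left (q.1 i) this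
    simp only [S, Finset.mem_biUnion, Finset.mem_Iic, Finset.mem_image, Finset.mem_range]
    exact ⟨q.1, hle, q.2, h1 q hq, rfl⟩
  · have : α q ≤ α.degree := Finsupp.le_degree q α
    simp only [Finset.mem_range]
    omega

theorem plethysmCoeff_mapDomain (f g : SymmFunc) (σ : Equiv.Perm ℕ) (c : ℕ →₀ ℕ) :
    plethysmCoeff f.1 g.1 (c.mapDomain σ) = plethysmCoeff f.1 g.1 c := by
  let s : (ℕ →₀ ℕ) × ℕ ≃ (ℕ →₀ ℕ) × ℕ :=
    (Finsupp.domCongr σ : (ℕ →₀ ℕ) ≃+ (ℕ →₀ ℕ)).toEquiv.prodCongr (Equiv.refl ℕ)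
  have hs1 : ∀ q, (s q).1 = q.1.mapDomain σ := fun q => by
    simp [s, Finsupp.equivMapDomain_eq_mapDomain]
  have hs2 : ∀ q, (s q).2 = q.2 := fun q => by simp [s]
  let t : (((ℕ →₀ ℕ) × ℕ) →₀ ℕ) ≃ (((ℕ →₀ ℕ) × ℕ) →₀ ℕ) :=
    (Finsupp.domCongr s : _ ≃+ (((ℕ →₀ ℕ) × ℕ) →₀ ℕ)).toEquiv
  have ht : ∀ α, t α = α.mapDomain s := fun α => by
    simp [t, Finsupp.equivMapDomain_eq_mapDomain]
  unfold plethysmCoeff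
  symm
  refine finsum_mem_eq_of_bijOn t (Equiv.bijOn t fun {α} => ?_) fun α _ => ?_
  · have hsupp : ∀ P : ((ℕ →₀ ℕ) × ℕ) → Prop,
        (∀ q ∈ (α.mapDomain s).support, P q) ↔ ∀ q ∈ α.support, P (s q) := by
      intro P
      rw [← Finsupp.equivMapDomain_eq_mapDomain]
      simp only [Finsupp.mem_support_iff, Finsupp.equivMapDomain_apply]
      exact ⟨fun h q hq => h (s q) (by simpa using hq), fun h q hq => by simpa using h _ hq⟩
    have hsum : (α.mapDomain s).sum (fun q m => m • q.1) =
        (α.sum (fun q m => m • q.1)).mapDomain σ := by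
      rw [← Finsupp.equivMapDomain_eq_mapDomain, Finsupp.sum_equivMapDomain]
      simp only [hs1, Finsupp.sum]
      rw [Finsupp.mapDomain_finsetSum]
      simp only [Finsupp.mapDomain_smul]
    have hinj := (Finsupp.mapDomain_injective (M := ℕ) σ.injective).eq_iff
      (a := α.sum (fun q m => m • q.1)) (b := c)
    simp only [plethysmIndex, Set.mem_ofPred_eq, ht, hsupp, hsum, hinj, hs1, hs2, g.2.1]
  · rw [ht, ← f.2.1 ((enum.symm.trans s).trans enum) (α.mapDomain enum),
      ← Finsupp.mapDomain_comp, ← Finsupp.mapDomain_comp]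
    have : (enum : (ℕ →₀ ℕ) × ℕ → ℕ) ∘ s = ((enum.symm.trans s).trans enum) ∘ enum := by
      funext q
      simp
    rw [this]

theorem plethysmCoeff_degree_le (f g : SymmFunc) :
    ∃ N : ℕ, ∀ c : ℕ →₀ ℕ, plethysmCoeff f.1 g.1 c ≠ 0 → c.degree ≤ N := by
  obtain ⟨N, hN⟩ := f.2.2
  obtain ⟨M, hM⟩ := g.2.2
  refine ⟨N * M, fun c h => ?_⟩
  obtain ⟨α, ⟨h1, h2⟩, hne⟩ := exists_ne_zero_of_finsum_mem_ne_zero h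
  have hdeg : α.degree ≤ N := by simpa using hN _ hne
  calc c.degree = ∑ q ∈ α.support, α q * q.1.degree := by
        rw [← h2, Finsupp.sum, map_sum]
        simp
    _ ≤ ∑ q ∈ α.support, α q * M := by
        refine Finset.sum_le_sum fun q hq => Nat.mul_le_mul_left _ (hM _ ?_)
        have := h1 q hq
        omega
    _ = α.degree * M := by rw [← Finset.sum_mul]; rfl
    _ ≤ N * M := Nat.mul_le_mul_right _ hdeg

/-- Plethysm `f ∘ g` of symmetric functions. -/
noncomputable def plethysm (f g : SymmFunc) : SymmFunc :=
  ⟨fun c => plethysmCoeff f.1 g.1 c, plethysmCoeff_mapDomain f g, plethysmCoeff_degree_le f g⟩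

/-- The `n`-fold plethysm power `f ∘ ⋯ ∘ f`; the identity for plethysm is `ψ₁ = ∑ᵢ xᵢ`. -/
noncomputable def plethysmPow (f : SymmFunc) : ℕ → SymmFunc
  | 0 => powerSum 1
  | n + 1 => plethysm f (plethysmPow f n)

/-! The `p`-typical symmetric functions. -/

/-- The symmetric function `d = ((∑ᵢ xᵢ)^p - ∑ᵢ xᵢ^p) / p`. The coefficientwise subtraction and
division are exact for `p` prime, see `powerSum_one_pow`. -/
noncomputable def dSymm (p : ℕ) : SymmFunc :=
  ⟨fun c => (MvPowerSeries.coeff c (powerSum 1 ^ p : SymmFunc).1 -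
      MvPowerSeries.coeff c (powerSum p).1) / p, by
    refine ⟨fun σ c => ?_, ?_⟩
    · change (_ - _) / p = (_ - _) / p
      rw [(powerSum 1 ^ p : SymmFunc).2.1, (powerSum p).2.1]
    · obtain ⟨N, hN⟩ := (powerSum 1 ^ p : SymmFunc).2.2
      refine ⟨N, fun c h => hN c fun h0 => h ?_⟩
      change (_ - _) / p = 0
      rw [h0]
      simp⟩

theorem coeff_powerSum (n : ℕ) (c : ℕ →₀ ℕ) [Decidable (∃ i : ℕ, c = Finsupp.single i n)] :
    MvPowerSeries.coeff c (powerSum n).1 = if ∃ i : ℕ, c = Finsupp.single i n then 1 else 0 := by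
  change @ite ℕ _ (Classical.propDecidable _) 1 0 = _
  congr

theorem killCompl_powerSum {ι : Type} [Fintype ι] (e : ι ↪ ℕ) (n : ℕ) (hn : n ≠ 0) :
    MvPowerSeries.killCompl e (powerSum n).1 = ∑ i : ι, (MvPowerSeries.X i) ^ n := by
  classical
  ext c
  rw [MvPowerSeries.coeff_killCompl, coeff_powerSum, map_sum]
  simp only [MvPowerSeries.coeff_X_pow]
  have key : ∀ k : ℕ, Finsupp.embDomain e c = Finsupp.single k n ↔
      ∃ i, e i = k ∧ c = Finsupp.single i n := by
    intro k
    constructor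
    · intro h
      have hk : k ∈ (Finsupp.embDomain e c).support := by rw [h]; simp [hn]
      rw [Finsupp.support_embDomain, Finset.mem_map] at hk
      obtain ⟨i, -, rfl⟩ := hk
      refine ⟨i, rfl, Finsupp.embDomain_injective e ?_⟩
      rw [h, Finsupp.embDomain_single]
    · rintro ⟨i, rfl, rfl⟩
      rw [Finsupp.embDomain_single]
  by_cases h : ∃ i, c = Finsupp.single i n
  · obtain ⟨i, rfl⟩ := h
    rw [if_pos ⟨e i, (key _).2 ⟨i, rfl, rfl⟩⟩]
    simp [Finsupp.single_left_inj hn]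
  · rw [if_neg, Finset.sum_eq_zero]
    · intro i _
      rw [if_neg fun h' => h ⟨i, h'⟩]
    · rintro ⟨k, hk⟩
      obtain ⟨i, -, hi⟩ := (key k).1 hk
      exact h ⟨i, hi⟩

theorem coeff_powerSum_one_pow (p : ℕ) [Fact p.Prime] (c : ℕ →₀ ℕ) :
    MvPowerSeries.coeff c (powerSum p).1 ≤ MvPowerSeries.coeff c (powerSum 1 ^ p : SymmFunc).1 ∧
    p ∣ MvPowerSeries.coeff c (powerSum 1 ^ p : SymmFunc).1 -
      MvPowerSeries.coeff c (powerSum p).1 := by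
  classical
  have hp : p ≠ 0 := (Fact.out : p.Prime).ne_zero
  have hle : MvPowerSeries.coeff c (powerSum p).1 ≤
      MvPowerSeries.coeff c (powerSum 1 ^ p : SymmFunc).1 := by
    rw [coeff_powerSum]
    split_ifs with h
    · obtain ⟨k, rfl⟩ := h
      let e : Unit ↪ ℕ := ⟨fun _ => k, fun _ _ _ => rfl⟩
      have he : Finsupp.single k p = Finsupp.embDomain e (Finsupp.single () p) := by
        rw [Finsupp.embDomain_single]; rfl
      change 1 ≤ MvPowerSeries.coeff _ ((powerSum 1).1 ^ p)
      rw [he, ← MvPowerSeries.coeff_killCompl, map_pow, killCompl_powerSum e 1 one_ne_zero]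
      simp [MvPowerSeries.coeff_X_pow]
    · exact Nat.zero_le _
  refine ⟨hle, (Nat.modEq_iff_dvd' hle).1 ((ZMod.natCast_eq_natCast_iff _ _ p).1 ?_)⟩
  let e : c.support ↪ ℕ := Function.Embedding.subtype _
  have hc : c = Finsupp.embDomain e (c.comapDomain e e.injective.injOn) := by
    rw [Finsupp.embDomain_comapDomain]
    intro i hi
    exact ⟨⟨i, hi⟩, rfl⟩
  have hch : CharP (MvPowerSeries c.support (ZMod p)) p :=
    charP_of_injective_algebraMap (MvPowerSeries.C_injective) p
  change _ = ((MvPowerSeries.coeff c ((powerSum 1).1 ^ p) : ℕ) : ZMod p)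
  rw [hc, ← MvPowerSeries.coeff_killCompl, ← MvPowerSeries.coeff_killCompl, map_pow,
    killCompl_powerSum e 1 one_ne_zero, killCompl_powerSum e p hp]
  simp only [pow_one]
  have h := sum_pow_char p Finset.univ
    (fun i : c.support => (MvPowerSeries.X i : MvPowerSeries c.support (ZMod p)))
  have h2 := congrArg (MvPowerSeries.coeff (c.comapDomain e e.injective.injOn)) h
  have hm : ∀ f : MvPowerSeries c.support ℕ,
      ((MvPowerSeries.coeff (c.comapDomain e e.injective.injOn) f : ℕ) : ZMod p) =
      MvPowerSeries.coeff (c.comapDomain e e.injective.injOn)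
        (MvPowerSeries.map (Nat.castRingHom (ZMod p)) f) := fun f => by
    rw [MvPowerSeries.coeff_map]; rfl
  rw [hm, hm]
  simp only [map_sum, map_pow, MvPowerSeries.map_X] at h2 ⊢
  exact h2.symm

theorem powerSum_one_pow (p : ℕ) [Fact p.Prime] :
    (powerSum 1) ^ p = p • dSymm p + powerSum p := by
  apply Subtype.ext
  ext c
  obtain ⟨h1, h2⟩ := coeff_powerSum_one_pow p c
  have h3 : MvPowerSeries.coeff c (p • dSymm p + powerSum p : SymmFunc).1 =
      p * ((MvPowerSeries.coeff c (powerSum 1 ^ p : SymmFunc).1 -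
        MvPowerSeries.coeff c (powerSum p).1) / p) + MvPowerSeries.coeff c (powerSum p).1 := by
    change MvPowerSeries.coeff c (p • (dSymm p).1 + (powerSum p).1) = _
    rw [map_add, map_nsmul, smul_eq_mul]
    rfl
  rw [h3, Nat.mul_div_cancel' h2]
  omega

/-- `d_{i,j} = d^{∘ i} ∘ ψ_p^{∘ j}`. -/
noncomputable def dTypical (p i j : ℕ) : SymmFunc :=
  plethysm (plethysmPow (dSymm p) i) (plethysmPow (powerSum p) j)

/-- The semiring `Λ_{ℕ,(p)}` of `p`-typical symmetric functions. -/
noncomputable def PTypicalSymm (p : ℕ) : Subsemiring SymmFunc :=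
  Subsemiring.closure {f | ∃ i j : ℕ, f = dTypical p i j}

theorem dTypical_mem (p i j : ℕ) : dTypical p i j ∈ PTypicalSymm p :=
  Subsemiring.subset_closure ⟨i, j, rfl⟩

/-- `d_{i,j}` as an element of `Λ_{ℕ,(p)}`. -/
noncomputable def dGen (p i j : ℕ) : PTypicalSymm p :=
  ⟨dTypical p i j, dTypical_mem p i j⟩

/-! Witt vectors. -/

/-- The big Witt vectors `W(A)`. -/
abbrev Witt (A : Type*) [CommSemiring A] : Type _ := SymmFunc →+* A

/-- The `p`-typical Witt vectors `W_{(p)}(A)`. -/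
abbrev PTypicalWitt (p : ℕ) (A : Type*) [CommSemiring A] : Type _ := PTypicalSymm p →+* A

/-- The canonical map `W(A) → W_{(p)}(A)`, restriction along `Λ_{ℕ,(p)} ⊆ Λ_ℕ`. -/
noncomputable def canonicalMap (p : ℕ) (A : Type*) [CommSemiring A] (w : Witt A) :
    PTypicalWitt p A :=
  w.comp (PTypicalSymm p).subtype

end BooleanWitt

namespace BooleanWitt

/-! Values in the Boolean semiring. -/

namespace BoolSemiring

/-! In `BoolSemiring` a sum vanishes only if every term does, and a product only if some factor
does. A homomorphism to it is therefore known from its zeros on generators, and each classification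
amounts to showing that these zeros form a principal upper set of ℕ², or the empty set.

For Λ_ℕ, the partitions λ with w(m_λ) = 0 form an upper set under containment. If m_λ is killed, so
is a product of rectangular m_μ all of whose constituents contain λ; hence some rectangle inside λ
is killed (`exists_rect_eq_zero`). The killed rectangles are closed under intersection
(`rect_eq_zero_inf`), because a high power of the intersection rectangle has only constituents
containing one of the two given ones. So one corner (x, y) decides everything. Conversely, `hookHom
x y` sends f to 1 exactly when f has a constituent fitting in the hook with x unrestricted rows and
all other parts at most y.

For the p-typical semiring, the relation d_{i,j}^p = p d_{i+1,j} + d_{i,j+1} (`dGen_pow`) says that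
d_{i,j} is killed if and only if both d_{i+1,j} and d_{i,j+1} are. This makes the zero set upper and
closed under infima. Existence goes through ℝ: the power sums ψ_{p^j} are algebraically independent,
so they may be given arbitrary real values, and the relation then determines every d_{i,j}. A
nonnegative real array satisfying the relation with the prescribed zeros (`exists_real_array`) gives
a homomorphism to the nonnegative reals, and recording whether a value is zero gives one to
`BoolSemiring`.

For the canonical map, the monomials of d_{i,j} are the p^j-th powers of those of d^{∘i}, and d
contains every monomial of degree p except the pure powers. If p is odd, two variables suffice for a
monomial in every d^{∘i}; if p = 2, three suffice. So all d_{i,j} survive when x is at least that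
number. In the remaining cases every monomial of d^{∘x} involves more than x variables, so d_{x,j}
dies once p^j > y. It survives for p^j ≤ y because d^{∘x} has a squarefree monomial, and d_{i,j}
survives for i < x because d^{∘i} has a monomial in at most x variables. -/

theorem one_ne_zero' : (1 : BoolSemiring) ≠ 0 := fun h => by cases h

instance : Nontrivial BoolSemiring := ⟨⟨1, 0, one_ne_zero'⟩⟩

theorem ne_zero_iff {a : BoolSemiring} : a ≠ 0 ↔ a = 1 := by
  cases a
  · exact ⟨fun h => absurd rfl h, fun h => by cases h⟩
  · exact ⟨fun _ => rfl, fun _ h => by cases h⟩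

theorem eq_of_zero_iff {a b : BoolSemiring} (h : a = 0 ↔ b = 0) : a = b := by
  by_cases hb : b = 0
  · rw [hb, h.2 hb]
  · rw [ne_zero_iff.1 hb, ne_zero_iff.1 (fun ha => hb (h.1 ha))]

theorem add_eq_zero {a b : BoolSemiring} : a + b = 0 ↔ a = 0 ∧ b = 0 := by
  cases a
  · exact ⟨fun h => ⟨rfl, h⟩, fun h => h.2⟩
  · exact ⟨fun h => (by cases h), fun h => (by cases h.1)⟩

instance : NoZeroDivisors BoolSemiring where
  eq_zero_or_eq_zero_of_mul_eq_zero {a b} h := by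
    cases a
    · exact Or.inl rfl
    · exact Or.inr h

theorem nsmul_eq_zero {n : ℕ} {a : BoolSemiring} : n • a = 0 ↔ n = 0 ∨ a = 0 := by
  induction n with
  | zero => simp
  | succ n ih => rw [succ_nsmul, add_eq_zero, ih]; simp; tauto

theorem sum_eq_zero {ι : Type*} {s : Finset ι} {f : ι → BoolSemiring} :
    ∑ i ∈ s, f i = 0 ↔ ∀ i ∈ s, f i = 0 := by
  classical
  induction s using Finset.induction_on with
  | empty => simp
  | insert a s ha ih => rw [Finset.sum_insert ha, add_eq_zero, ih]; simp

end BoolSemiring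

/-! Supports of symmetric functions. -/

section Support

variable {τ : Type*}

theorem coeff_mul_ne_zero {f g : MvPowerSeries τ ℕ} {c : τ →₀ ℕ} :
    MvPowerSeries.coeff c (f * g) ≠ 0 ↔
      ∃ a b, a + b = c ∧ MvPowerSeries.coeff a f ≠ 0 ∧ MvPowerSeries.coeff b g ≠ 0 := by
  classical
  rw [MvPowerSeries.coeff_mul]
  constructor
  · intro h
    obtain ⟨⟨a, b⟩, hab, hne⟩ := Finset.exists_ne_zero_of_sum_ne_zero h
    exact ⟨a, b, Finset.HasAntidiagonal.mem_antidiagonal.1 hab, left_ne_zero_of_mul hne,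
      right_ne_zero_of_mul hne⟩
  · rintro ⟨a, b, hab, ha, hb⟩ h
    rw [Finset.sum_eq_zero_iff] at h
    exact mul_ne_zero ha hb (h (a, b) (Finset.HasAntidiagonal.mem_antidiagonal.2 hab))

theorem coeff_add_ne_zero {f g : MvPowerSeries τ ℕ} {c : τ →₀ ℕ} :
    MvPowerSeries.coeff c (f + g) ≠ 0 ↔
      MvPowerSeries.coeff c f ≠ 0 ∨ MvPowerSeries.coeff c g ≠ 0 := by
  rw [map_add]
  omega

theorem coeff_one_ne_zero {c : τ →₀ ℕ} :
    MvPowerSeries.coeff c (1 : MvPowerSeries τ ℕ) ≠ 0 ↔ c = 0 := by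
  classical
  rw [MvPowerSeries.coeff_one]
  simp

end Support

/-! ### Monomial symmetric functions and rearrangements of exponents. -/

theorem coeff_monomialSymm (l : Part) (c : ℕ →₀ ℕ)
    [Decidable (∃ σ : Equiv.Perm ℕ, l.1.mapDomain σ = c)] :
    MvPowerSeries.coeff c (monomialSymm l).1 =
      if ∃ σ : Equiv.Perm ℕ, l.1.mapDomain σ = c then 1 else 0 := by
  change @ite ℕ _ (Classical.propDecidable _) 1 0 = _
  congr

theorem coeff_monomialSymm_ne_zero {l : Part} {c : ℕ →₀ ℕ} :
    MvPowerSeries.coeff c (monomialSymm l).1 ≠ 0 ↔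
      ∃ σ : Equiv.Perm ℕ, l.1.mapDomain σ = c := by
  classical
  rw [coeff_monomialSymm]
  simp

theorem mapDomain_perm_apply (c : ℕ →₀ ℕ) (σ : Equiv.Perm ℕ) (k : ℕ) :
    c.mapDomain σ (σ k) = c k :=
  Finsupp.mapDomain_apply σ.injective c k

theorem mapDomain_perm_apply' (c : ℕ →₀ ℕ) (σ : Equiv.Perm ℕ) (k : ℕ) :
    c.mapDomain σ k = c (σ.symm k) := by
  conv_lhs => rw [← σ.apply_symm_apply k]
  exact mapDomain_perm_apply c σ _

/-- Every exponent is a rearrangement of a partition. -/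
theorem exists_part_mapDomain_eq (c : ℕ →₀ ℕ) :
    ∃ (l : Part) (σ : Equiv.Perm ℕ), l.1.mapDomain σ = c := by
  obtain ⟨n, hn⟩ : ∃ n, ∀ k, n ≤ k → c k = 0 := by
    refine ⟨c.support.sup id + 1, fun k hk => ?_⟩
    by_contra h
    have := Finset.le_sup (f := id) (Finsupp.mem_support_iff.2 h)
    simp only [id] at this
    omega
  -- The order dual makes the increasing sort produce a weakly decreasing sequence.
  let f : Fin n → ℕᵒᵈ := fun i => OrderDual.toDual (c i)
  let ρ : Equiv.Perm (Fin n) := Tuple.sort f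
  have hρ : Monotone (f ∘ ρ) := Tuple.monotone_sort f
  let σ : Equiv.Perm ℕ := ρ.extendDomain Fin.equivSubtype
  have hσ1 : ∀ k (hk : k < n), σ k = ρ ⟨k, hk⟩ := fun k hk => by
    have := Equiv.Perm.extendDomain_apply_image ρ Fin.equivSubtype ⟨k, hk⟩
    simpa using this
  have hσ2 : ∀ k, n ≤ k → σ k = k := fun k hk =>
    Equiv.Perm.extendDomain_apply_not_subtype ρ Fin.equivSubtype (by simpa using hk)
  refine ⟨⟨c.mapDomain σ.symm, fun i j hij => ?_⟩, σ, ?_⟩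
  · rw [mapDomain_perm_apply', mapDomain_perm_apply', Equiv.symm_symm]
    by_cases hj : j < n
    · rw [hσ1 j hj, hσ1 i (hij.trans_lt hj)]
      have h : (⟨i, hij.trans_lt hj⟩ : Fin n) ≤ ⟨j, hj⟩ := hij
      exact OrderDual.toDual_le_toDual.1 (hρ h)
    · rw [hσ2 j (not_lt.1 hj), hn j (not_lt.1 hj)]
      exact Nat.zero_le _
  · rw [← Finsupp.mapDomain_comp]
    simp

/-- If a rearrangement of a partition is contained in another partition, so is the partition
itself. -/
theorem part_le_of_mapDomain_le {l n : Part} {σ : Equiv.Perm ℕ}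
    (h : l.1.mapDomain σ ≤ n.1) : l.1 ≤ n.1 := by
  intro k
  -- Pigeonhole: k + 1 indices cannot all be sent into k positions, so one of the k + 1 largest
  -- parts lands at position k or later. The same argument recurs below.
  obtain ⟨i, hi, hk⟩ : ∃ i ∈ Finset.range (k + 1), σ i ∉ Finset.range k := by
    by_contra! h0
    have := Finset.card_le_card_of_injOn σ h0 σ.injective.injOn
    simp at this
  rw [Finset.mem_range] at hi hk
  calc l.1 k ≤ l.1 i := l.2 (by omega)
    _ = l.1.mapDomain σ (σ i) := (mapDomain_perm_apply _ _ _).symm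
    _ ≤ n.1 (σ i) := h _
    _ ≤ n.1 k := n.2 (by omega)

theorem part_eq_of_mapDomain_eq {l n : Part} {σ : Equiv.Perm ℕ}
    (h : l.1.mapDomain σ = n.1) : l = n := by
  refine Subtype.ext (le_antisymm (part_le_of_mapDomain_le h.le)
    (part_le_of_mapDomain_le (σ := σ.symm) (le_of_eq ?_)))
  rw [← h, ← Finsupp.mapDomain_comp]
  simp

/-- The partition `0`. -/
def zeroPart : Part := ⟨0, fun _ _ _ => le_rfl⟩

theorem monomialSymm_zeroPart : monomialSymm zeroPart = 1 := by
  classical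
  refine Subtype.ext (MvPowerSeries.ext fun c => ?_)
  rw [coeff_monomialSymm]
  change _ = MvPowerSeries.coeff c (1 : MvPowerSeries ℕ ℕ)
  rw [MvPowerSeries.coeff_one]
  simp [zeroPart, eq_comm]

theorem exists_part_coeff_ne_zero {f : SymmFunc} {c : ℕ →₀ ℕ}
    (hc : MvPowerSeries.coeff c f.1 ≠ 0) :
    ∃ (l : Part) (σ : Equiv.Perm ℕ), l.1.mapDomain σ = c ∧
      MvPowerSeries.coeff l.1 f.1 ≠ 0 := by
  obtain ⟨l, σ, rfl⟩ := exists_part_mapDomain_eq c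
  exact ⟨l, σ, rfl, by rwa [f.2.1] at hc⟩

theorem exists_part_of_coeff_mul {f g : SymmFunc} {n : Part}
    (h : MvPowerSeries.coeff n.1 (f * g).1 ≠ 0) :
    ∃ l m : Part, l.1 ≤ n.1 ∧ m.1 ≤ n.1 ∧
      MvPowerSeries.coeff l.1 f.1 ≠ 0 ∧ MvPowerSeries.coeff m.1 g.1 ≠ 0 := by
  obtain ⟨a, b, hab, ha, hb⟩ := coeff_mul_ne_zero.1 h
  obtain ⟨l, σ, rfl, hl⟩ := exists_part_coeff_ne_zero ha
  obtain ⟨m, τ, rfl, hm⟩ := exists_part_coeff_ne_zero hb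
  exact ⟨l, m, part_le_of_mapDomain_le (le_of_le_of_eq le_self_add hab),
    part_le_of_mapDomain_le (le_of_le_of_eq le_add_self hab), hl, hm⟩

/-- The homomorphism `Λ_ℕ → B` with `f ↦ 1` if and only if some `m_λ` with `λ ∈ P` occurs
in `f`. -/
noncomputable def homOfSet (P : Set Part) (h0 : zeroPart ∈ P)
    (hdown : ∀ l n : Part, n ∈ P → l.1 ≤ n.1 → l ∈ P)
    (hadd : ∀ l m : Part, l ∈ P → m ∈ P → ∃ n ∈ P, ∃ σ τ : Equiv.Perm ℕ,
      l.1.mapDomain σ + m.1.mapDomain τ = n.1) : Witt BoolSemiring := by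
  classical
  exact
  { toFun := fun f => if ∃ l ∈ P, MvPowerSeries.coeff l.1 f.1 ≠ 0 then 1 else 0
    map_one' := if_pos ⟨zeroPart, h0, coeff_one_ne_zero.2 rfl⟩
    map_zero' := if_neg fun ⟨l, _, h⟩ => h rfl
    map_add' := fun f g => by
      have : (∃ l ∈ P, MvPowerSeries.coeff l.1 (f + g).1 ≠ 0) ↔
          (∃ l ∈ P, MvPowerSeries.coeff l.1 f.1 ≠ 0) ∨
            ∃ l ∈ P, MvPowerSeries.coeff l.1 g.1 ≠ 0 := by
        change (∃ l ∈ P, MvPowerSeries.coeff l.1 (f.1 + g.1) ≠ 0) ↔ _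
        simp only [coeff_add_ne_zero]
        grind
      refine BoolSemiring.eq_of_zero_iff ?_
      rw [BoolSemiring.add_eq_zero]
      simp only [this, ite_eq_right_iff, BoolSemiring.one_ne_zero']
      exact not_or
    map_mul' := fun f g => by
      have : (∃ l ∈ P, MvPowerSeries.coeff l.1 (f * g).1 ≠ 0) ↔
          (∃ l ∈ P, MvPowerSeries.coeff l.1 f.1 ≠ 0) ∧
            ∃ l ∈ P, MvPowerSeries.coeff l.1 g.1 ≠ 0 := by
        constructor
        · rintro ⟨n, hn, h⟩
          obtain ⟨l, m, hl, hm, hlf, hmg⟩ := exists_part_of_coeff_mul h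
          exact ⟨⟨l, hdown l n hn hl, hlf⟩, ⟨m, hdown m n hn hm, hmg⟩⟩
        · rintro ⟨⟨l, hl, hlf⟩, ⟨m, hm, hmg⟩⟩
          obtain ⟨n, hn, σ, τ, h⟩ := hadd l m hl hm
          refine ⟨n, hn, coeff_mul_ne_zero.2 ⟨_, _, h, ?_, ?_⟩⟩
          · rwa [f.2.1]
          · rwa [g.2.1]
      refine BoolSemiring.eq_of_zero_iff ?_
      rw [mul_eq_zero]
      simp only [this, ite_eq_right_iff, BoolSemiring.one_ne_zero']
      exact not_and_or }

theorem homOfSet_eq_zero {P : Set Part} {h0 hdown hadd} {f : SymmFunc} :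
    homOfSet P h0 hdown hadd f = 0 ↔ ∀ l ∈ P, MvPowerSeries.coeff l.1 f.1 = 0 := by
  classical
  change (if ∃ l ∈ P, MvPowerSeries.coeff l.1 f.1 ≠ 0 then (1 : BoolSemiring) else 0) = 0 ↔ _
  rw [ite_eq_right_iff]
  simp only [BoolSemiring.one_ne_zero', imp_false, not_exists, not_and, not_not]

/-! ### The homomorphisms with coordinates (x, y) and ∞. -/

theorem exists_part_eventually_zero (l : Part) : ∃ n, ∀ k, n ≤ k → l.1 k = 0 := by
  refine ⟨l.1.support.sup id + 1, fun k hk => ?_⟩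
  by_contra h
  have := Finset.le_sup (f := id) (Finsupp.mem_support_iff.2 h)
  simp only [id] at this
  omega

/-- The permutation which exchanges `[x, x + n)` and `[x + n, x + 2 n)`. -/
def blockSwap (x n : ℕ) : Equiv.Perm ℕ :=
  Function.Involutive.toPerm
    (fun k => if k < x then k else if k < x + n then k + n else
      if k < x + 2 * n then k - n else k) (by intro k; grind)

/-- The homomorphism with coordinates `(x, y)`. -/
noncomputable def hookHom (x y : ℕ) : Witt BoolSemiring :=
  homOfSet {l | l.1 x ≤ y} (Nat.zero_le _) (fun l n hn hl => (hl x).trans hn) <| by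
    intro l m hl hm
    obtain ⟨a, ha⟩ := exists_part_eventually_zero l
    obtain ⟨b, hb⟩ := exists_part_eventually_zero m
    -- The first x positions may grow freely. Beyond them the tail of `m` is moved past the support
    -- of `l`, so at each position at most one summand is nonzero and the bound y persists.
    have key : ∀ k, x ≤ k → (l.1 + m.1.mapDomain (blockSwap x (a + b))) k ≤ y := by
      intro k hk
      rw [Finsupp.add_apply, mapDomain_perm_apply']
      have hs : (blockSwap x (a + b)).symm k =
        if k < x then k else if k < x + (a + b) then k + (a + b) else
          if k < x + 2 * (a + b) then k - (a + b) else k := rfl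
      rw [hs, if_neg (by omega)]
      have hlk : l.1 k ≤ y := (l.2 hk).trans hl
      split_ifs with h1 h2
      · rw [hb _ (by omega)]
        exact hlk
      · rw [ha k (by omega), zero_add]
        exact (m.2 (by omega)).trans hm
      · rw [ha k (by omega), zero_add]
        exact (m.2 hk).trans hm
    obtain ⟨n, ρ, hn⟩ := exists_part_mapDomain_eq
      (l.1 + m.1.mapDomain (blockSwap x (a + b)))
    refine ⟨n, ?_, ρ.symm, (blockSwap x (a + b)).trans ρ.symm, ?_⟩
    · obtain ⟨i, hi, hk⟩ : ∃ i ∈ Finset.range (x + 1), ρ i ∉ Finset.range x := by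
        by_contra! h0
        have := Finset.card_le_card_of_injOn ρ h0 ρ.injective.injOn
        simp at this
      rw [Finset.mem_range] at hi hk
      have h1 := key (ρ i) (by omega)
      rw [← hn, mapDomain_perm_apply] at h1
      exact (n.2 (by omega)).trans h1
    · rw [Equiv.coe_trans, Finsupp.mapDomain_comp, ← Finsupp.mapDomain_add, ← hn,
        ← Finsupp.mapDomain_comp]
      simp

theorem hookHom_eq_zero {x y : ℕ} {f : SymmFunc} :
    hookHom x y f = 0 ↔ ∀ l : Part, l.1 x ≤ y → MvPowerSeries.coeff l.1 f.1 = 0 :=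
  homOfSet_eq_zero

/-- The homomorphism with coordinate `∞`. -/
noncomputable def topHom : Witt BoolSemiring :=
  homOfSet Set.univ trivial (fun _ _ _ _ => trivial) fun l m _ _ => by
    obtain ⟨n, ρ, hn⟩ := exists_part_mapDomain_eq (l.1 + m.1)
    refine ⟨n, trivial, ρ.symm, ρ.symm, ?_⟩
    rw [← Finsupp.mapDomain_add, ← hn, ← Finsupp.mapDomain_comp]
    simp

theorem topHom_eq_zero {f : SymmFunc} :
    topHom f = 0 ↔ ∀ l : Part, MvPowerSeries.coeff l.1 f.1 = 0 :=
  homOfSet_eq_zero.trans ⟨fun h l => h l trivial, fun h l _ => h l⟩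

theorem topHom_ne_zero {f : SymmFunc} {c : ℕ →₀ ℕ} (hc : MvPowerSeries.coeff c f.1 ≠ 0) :
    topHom f ≠ 0 := fun h => by
  obtain ⟨l, σ, -, hl⟩ := exists_part_coeff_ne_zero hc
  exact hl (topHom_eq_zero.1 h l)

/-- A test for survival that needs no sorting: a monomial of f may have large exponents at any x
positions, not just the first x. -/
theorem hookHom_ne_zero {x y : ℕ} {f : SymmFunc} {c : ℕ →₀ ℕ}
    (hc : MvPowerSeries.coeff c f.1 ≠ 0) {s : Finset ℕ} (hs : s.card ≤ x)
    (h : ∀ k, k ∉ s → c k ≤ y) : hookHom x y f ≠ 0 := fun h0 => by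
  obtain ⟨l, σ, rfl, hl⟩ := exists_part_coeff_ne_zero hc
  refine hl (hookHom_eq_zero.1 h0 l ?_)
  obtain ⟨i, hi, hk⟩ : ∃ i ∈ Finset.range (x + 1), σ i ∉ s := by
    by_contra! h0
    have := Finset.card_le_card_of_injOn σ h0 σ.injective.injOn
    simp only [Finset.card_range] at this
    omega
  rw [Finset.mem_range] at hi
  have h1 := h (σ i) hk
  rw [mapDomain_perm_apply] at h1
  exact (l.2 (by omega)).trans h1

theorem hookHom_monomialSymm {x y : ℕ} {l : Part} :
    hookHom x y (monomialSymm l) = 0 ↔ y + 1 ≤ l.1 x := by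
  rw [hookHom_eq_zero]
  constructor
  · intro h
    by_contra hl
    exact coeff_monomialSymm_ne_zero.2 ⟨Equiv.refl ℕ, by simp⟩ (h l (by omega))
  · intro h n hn
    by_contra hne
    obtain ⟨σ, hσ⟩ := coeff_monomialSymm_ne_zero.1 hne
    rw [part_eq_of_mapDomain_eq hσ] at h
    omega

theorem topHom_monomialSymm {l : Part} : topHom (monomialSymm l) = 1 :=
  BoolSemiring.ne_zero_iff.1
    (topHom_ne_zero (coeff_monomialSymm_ne_zero.2 ⟨Equiv.refl ℕ, by simp; rfl⟩))

/-! Classification of the homomorphisms `Λ_ℕ → B`. -/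

theorem card_support_le_degree (c : ℕ →₀ ℕ) : c.support.card ≤ c.degree := by
  rw [Finsupp.degree_apply, Finset.card_eq_sum_ones]
  exact Finset.sum_le_sum fun i hi => Nat.one_le_iff_ne_zero.2 (Finsupp.mem_support_iff.1 hi)

theorem lt_degree_of_part_ne_zero {l : Part} {k : ℕ} (h : l.1 k ≠ 0) : k < l.1.degree := by
  have : Finset.range (k + 1) ⊆ l.1.support := fun i hi => by
    rw [Finsupp.mem_support_iff]
    have := l.2 (Nat.lt_succ_iff.1 (Finset.mem_range.1 hi))
    omega
  have := (Finset.card_le_card this).trans (card_support_le_degree l.1)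
  simp only [Finset.card_range] at this
  omega

theorem finite_part_degree_le (N : ℕ) : {l : Part | l.1.degree ≤ N}.Finite := by
  classical
  refine Set.Finite.of_finite_image (f := Subtype.val) ?_ Subtype.val_injective.injOn
  refine ((Finset.finsupp (Finset.range N) fun _ => Finset.range (N + 1)).finite_toSet).subset ?_
  rintro _ ⟨l, hl, rfl⟩
  change l.1.degree ≤ N at hl
  rw [Finset.mem_coe, Finset.mem_finsupp_iff]
  refine ⟨fun k hk => ?_, fun k _ => ?_⟩
  · have := lt_degree_of_part_ne_zero (Finsupp.mem_support_iff.1 hk)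
    simp only [Finset.mem_range]
    omega
  · have := Finsupp.le_degree k l.1
    simp only [Finset.mem_range]
    omega

theorem finite_part_coeff_ne_zero (f : SymmFunc) :
    {l : Part | MvPowerSeries.coeff l.1 f.1 ≠ 0}.Finite := by
  obtain ⟨N, hN⟩ := f.2.2
  exact (finite_part_degree_le N).subset fun l hl => hN _ hl

/-- The monomial symmetric functions span `Λ_ℕ`. -/
theorem eq_sum_monomialSymm (f : SymmFunc) :
    f = ∑ l ∈ (finite_part_coeff_ne_zero f).toFinset,
      MvPowerSeries.coeff l.1 f.1 • monomialSymm l := by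
  classical
  refine Subtype.ext (MvPowerSeries.ext fun c => ?_)
  have h : MvPowerSeries.coeff c (∑ l ∈ (finite_part_coeff_ne_zero f).toFinset,
      MvPowerSeries.coeff l.1 f.1 • monomialSymm l : SymmFunc).1 =
      ∑ l ∈ (finite_part_coeff_ne_zero f).toFinset,
        MvPowerSeries.coeff l.1 f.1 * MvPowerSeries.coeff c (monomialSymm l).1 := by
    rw [AddSubmonoidClass.coe_finsetSum, map_sum]
    refine Finset.sum_congr rfl fun l _ => ?_
    change MvPowerSeries.coeff c (_ • (monomialSymm l).1) = _
    rw [map_nsmul, smul_eq_mul]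
  rw [h]
  obtain ⟨l, σ, rfl⟩ := exists_part_mapDomain_eq c
  rw [f.2.1, Finset.sum_eq_single l]
  · rw [coeff_monomialSymm, if_pos ⟨σ, rfl⟩, mul_one]
  · intro n _ hn
    rw [coeff_monomialSymm, if_neg, mul_zero]
    rintro ⟨τ, hτ⟩
    refine hn (part_eq_of_mapDomain_eq (σ := τ.trans σ.symm) ?_)
    rw [Equiv.coe_trans, Finsupp.mapDomain_comp, hτ, ← Finsupp.mapDomain_comp]
    simp
  · intro hl
    simp only [Set.Finite.mem_toFinset, Set.mem_ofPred_eq, not_not] at hl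
    rw [hl, zero_mul]

/-- Since f is an ℕ-combination of the m_λ and sums in `BoolSemiring` vanish only termwise, w is
determined by the set of λ with w(m_λ) = 0. -/
theorem witt_eq_zero_iff (w : Witt BoolSemiring) (f : SymmFunc) :
    w f = 0 ↔ ∀ l : Part, MvPowerSeries.coeff l.1 f.1 ≠ 0 → w (monomialSymm l) = 0 := by
  conv_lhs => rw [eq_sum_monomialSymm f]
  rw [map_sum, BoolSemiring.sum_eq_zero]
  refine forall_congr' fun l => ?_
  rw [map_nsmul, BoolSemiring.nsmul_eq_zero, Set.Finite.mem_toFinset]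
  simp only [Set.mem_ofPred_eq]
  tauto

theorem witt_ext {v w : Witt BoolSemiring}
    (h : ∀ l : Part, v (monomialSymm l) = 0 ↔ w (monomialSymm l) = 0) : v = w := by
  refine RingHom.ext fun f => BoolSemiring.eq_of_zero_iff ?_
  rw [witt_eq_zero_iff v, witt_eq_zero_iff w]
  simp only [h]

/-- The function m_n occurs in the product of m_l with the monomial symmetric function of the sorted
difference n − l. -/
theorem witt_monomialSymm_mono {w : Witt BoolSemiring} {l n : Part} (hln : l.1 ≤ n.1)
    (hl : w (monomialSymm l) = 0) : w (monomialSymm n) = 0 := by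
  obtain ⟨m, σ, hm⟩ := exists_part_mapDomain_eq (n.1 - l.1)
  have h : w (monomialSymm l * monomialSymm m) = 0 := by rw [map_mul, hl, zero_mul]
  refine (witt_eq_zero_iff w _).1 h n (coeff_mul_ne_zero.2 ⟨l.1, n.1 - l.1, ?_, ?_, ?_⟩)
  · exact add_tsub_cancel_of_le hln
  · exact coeff_monomialSymm_ne_zero.2 ⟨Equiv.refl ℕ, by simp⟩
  · exact coeff_monomialSymm_ne_zero.2 ⟨σ, hm⟩

/-- The partition with `a` parts equal to `b`. -/
noncomputable def rect (a b : ℕ) : Part :=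
  ⟨∑ i ∈ Finset.range a, Finsupp.single i b, fun i j hij => by
    simp only [Finsupp.finsetSum_apply, Finsupp.single_apply, Finset.sum_ite_eq',
      Finset.mem_range]
    grind⟩

theorem rect_apply (a b k : ℕ) : (rect a b).1 k = if k < a then b else 0 := by
  simp [rect, Finsupp.finsetSum_apply, Finsupp.single_apply]

theorem rect_le_iff {a b : ℕ} {l : Part} : (rect (a + 1) b).1 ≤ l.1 ↔ b ≤ l.1 a := by
  constructor
  · intro h
    have := h a
    rwa [rect_apply, if_pos (Nat.lt_succ_self a)] at this
  · intro h k
    rw [rect_apply]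
    split_ifs with hk
    · exact h.trans (l.2 (Nat.lt_succ_iff.1 hk))
    · exact Nat.zero_le _

theorem rect_zero_right (a : ℕ) : rect a 0 = zeroPart := by
  refine Subtype.ext (Finsupp.ext fun k => ?_)
  rw [rect_apply]
  simp [zeroPart]

theorem exists_coeff_le_of_coeff_prod {ι : Type*} (s : Finset ι) (f : ι → SymmFunc)
    {c : ℕ →₀ ℕ} (h : MvPowerSeries.coeff c (∏ i ∈ s, f i).1 ≠ 0) :
    ∀ i ∈ s, ∃ a ≤ c, MvPowerSeries.coeff a (f i).1 ≠ 0 := by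
  classical
  intro i hi
  rw [← Finset.mul_prod_erase s f hi] at h
  obtain ⟨a, b, hab, ha, -⟩ := coeff_mul_ne_zero.1 h
  exact ⟨a, le_of_le_of_eq le_self_add hab, ha⟩

/-- If `m_λ ↦ 0`, then `m_μ ↦ 0` for some rectangle `μ` contained in `λ`. -/
theorem exists_rect_eq_zero {w : Witt BoolSemiring} {l : Part}
    (hl : w (monomialSymm l) = 0) : ∃ k, w (monomialSymm (rect (k + 1) (l.1 k))) = 0 := by
  obtain ⟨n, hn⟩ := exists_part_eventually_zero l
  -- The partition `l` is the union of these rectangles. A constituent of the product contains each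
  -- of them, hence contains `l`, so the whole product is killed, and with it one of the factors.
  have h : w (∏ k ∈ Finset.range n, monomialSymm (rect (k + 1) (l.1 k))) = 0 := by
    refine (witt_eq_zero_iff w _).2 fun m hm => witt_monomialSymm_mono (fun k => ?_) hl
    by_cases hk : k < n
    · obtain ⟨a, ham, ha⟩ := exists_coeff_le_of_coeff_prod _ _ hm k (Finset.mem_range.2 hk)
      obtain ⟨σ, rfl⟩ := coeff_monomialSymm_ne_zero.1 ha
      exact rect_le_iff.1 (part_le_of_mapDomain_le ham)
    · rw [hn k (not_lt.1 hk)]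
      exact Nat.zero_le _
  rw [map_prod, Finset.prod_eq_zero_iff] at h
  obtain ⟨k, -, hk⟩ := h
  exact ⟨k, hk⟩

/-- Each of the N factors puts b at a + 1 distinct positions, at least one of them outside `s`. So
the exponents outside `s` total at least N b. -/
theorem coeff_rect_pow {a b N : ℕ} {c : ℕ →₀ ℕ}
    (h : MvPowerSeries.coeff c (monomialSymm (rect (a + 1) b) ^ N).1 ≠ 0) :
    (∀ i, b ∣ c i) ∧ ∀ s : Finset ℕ, s.card ≤ a → N * b + ∑ i ∈ s, c i ≤ c.degree := by
  induction N generalizing c with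
  | zero =>
    rw [pow_zero] at h
    rw [coeff_one_ne_zero.1 h]
    simp
  | succ N ih =>
    rw [pow_succ] at h
    obtain ⟨u, v, rfl, hu, hv⟩ := coeff_mul_ne_zero.1 h
    obtain ⟨σ, rfl⟩ := coeff_monomialSymm_ne_zero.1 hv
    obtain ⟨h1, h2⟩ := ih hu
    have hv' : ∀ i, (rect (a + 1) b).1.mapDomain σ i = if σ.symm i < a + 1 then b else 0 :=
      fun i => by rw [mapDomain_perm_apply', rect_apply]
    refine ⟨fun i => ?_, fun s hs => ?_⟩
    · rw [Finsupp.add_apply, hv']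
      refine dvd_add (h1 i) ?_
      split_ifs <;> simp
    · obtain ⟨i, hi, hk⟩ : ∃ i ∈ Finset.range (a + 1), σ i ∉ s := by
        by_contra! h0
        have := Finset.card_le_card_of_injOn σ h0 σ.injective.injOn
        simp only [Finset.card_range] at this
        omega
      have h3 : b + ∑ i ∈ s, (rect (a + 1) b).1.mapDomain σ i ≤
          ((rect (a + 1) b).1.mapDomain σ).degree := by
        have h4 : (rect (a + 1) b).1.mapDomain σ (σ i) = b := by
          rw [mapDomain_perm_apply, rect_apply, if_pos (Finset.mem_range.1 hi)]
        calc _ = ∑ i ∈ insert (σ i) s, (rect (a + 1) b).1.mapDomain σ i := by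
              rw [Finset.sum_insert hk, h4]
          _ ≤ ∑ i ∈ insert (σ i) s ∪ ((rect (a + 1) b).1.mapDomain σ).support,
                (rect (a + 1) b).1.mapDomain σ i :=
              Finset.sum_le_sum_of_subset Finset.subset_union_left
          _ = _ := by
              rw [Finsupp.degree_apply]
              refine (Finset.sum_subset Finset.subset_union_right fun j _ hj => ?_).symm
              simpa using hj
      have h5 := h2 s hs
      rw [map_add]
      simp only [Finsupp.add_apply, Finset.sum_add_distrib]
      linarith

/-- The rectangles sent to `0` are closed under intersection. -/
theorem rect_eq_zero_inf {w : Witt BoolSemiring} {a b a' b' : ℕ} (ha : a ≤ a')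
    (h : w (monomialSymm (rect (a + 1) (b + 1))) = 0)
    (h' : w (monomialSymm (rect (a' + 1) (b' + 1))) = 0) :
    w (monomialSymm (rect (a + 1) (b' + 1))) = 0 := by
  -- The exponent exceeds (a' − a)(b + 1), which bounds the sum of the parts from index a on in a
  -- constituent containing neither given rectangle.
  have hpow : w (monomialSymm (rect (a + 1) (b' + 1)) ^ ((a' + 1) * (b + 1))) = 0 := by
    refine (witt_eq_zero_iff w _).2 fun l hl => ?_
    obtain ⟨h1, h2⟩ := coeff_rect_pow hl
    by_cases h3 : b + 1 ≤ l.1 a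
    · exact witt_monomialSymm_mono (rect_le_iff.2 h3) h
    by_cases h4 : b' + 1 ≤ l.1 a'
    · exact witt_monomialSymm_mono (rect_le_iff.2 h4) h'
    exfalso
    -- This part is a multiple of b' + 1 and at most b', so `l` has at most a' parts.
    have h5 : l.1 a' = 0 := Nat.eq_zero_of_dvd_of_lt (h1 a') (by omega)
    have h6 := h2 (Finset.range a) (by simp)
    have h7 : l.1.degree = ∑ i ∈ Finset.range a', l.1 i := by
      rw [Finsupp.degree_apply]
      refine Finset.sum_subset (fun i hi => ?_) fun i _ hi => by simpa using hi
      rw [Finset.mem_range]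
      by_contra hi'
      have := l.2 (not_lt.1 hi')
      rw [Finsupp.mem_support_iff] at hi
      omega
    rw [h7, ← Finset.sum_range_add_sum_Ico _ ha] at h6
    have h8 : ∑ i ∈ Finset.Ico a a', l.1 i ≤ (Finset.Ico a a').card • (b + 1) :=
      Finset.sum_le_card_nsmul _ _ _ fun i hi => by
        have := l.2 (Finset.mem_Ico.1 hi).1
        omega
    rw [Nat.card_Ico, smul_eq_mul] at h8
    have h9 : (a' - a) * (b + 1) < (a' + 1) * (b + 1) :=
      Nat.mul_lt_mul_of_pos_right (by omega) (by omega)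
    have h10 := Nat.le_mul_of_pos_right ((a' + 1) * (b + 1)) (Nat.succ_pos b')
    rw [Nat.succ_eq_add_one] at h10
    linarith
  rw [map_pow] at hpow
  exact pow_eq_zero_iff (by positivity) |>.1 hpow

/-- A nonempty upper set of `ℕ²` closed under infima is principal. -/
theorem exists_principal {T : ℕ → ℕ → Prop} (hup : ∀ a b a' b', a ≤ a' → b ≤ b' → T a b → T a' b')
    (hinf : ∀ a b a' b', a ≤ a' → b' ≤ b → T a b → T a' b' → T a b') (hne : ∃ a b, T a b) :
    ∃ x y, ∀ a b, T a b ↔ x ≤ a ∧ y ≤ b := by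
  classical
  have h1 : ∃ a, ∃ b, T a b := hne
  have h2 : ∃ b, ∃ a, T a b := let ⟨a, b, h⟩ := hne; ⟨b, a, h⟩
  refine ⟨Nat.find h1, Nat.find h2, fun a b => ⟨fun h => ?_, fun h => ?_⟩⟩
  · exact ⟨Nat.find_min' h1 ⟨b, h⟩, Nat.find_min' h2 ⟨a, h⟩⟩
  · obtain ⟨b', hb'⟩ := Nat.find_spec h1
    obtain ⟨a', ha'⟩ := Nat.find_spec h2
    refine hup _ _ _ _ h.1 h.2 (hinf _ b' a' _ ?_ ?_ hb' ha')
    · exact Nat.find_min' h1 ⟨_, ha'⟩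
    · exact Nat.find_min' h2 ⟨_, hb'⟩

theorem witt_classification (w : Witt BoolSemiring) :
    w = topHom ∨ ∃ x y, w = hookHom x y := by
  by_cases hne : ∃ a b, w (monomialSymm (rect (a + 1) (b + 1))) = 0
  · right
    obtain ⟨x, y, hxy⟩ := exists_principal
      (T := fun a b => w (monomialSymm (rect (a + 1) (b + 1))) = 0)
      (fun a b a' b' ha hb h => witt_monomialSymm_mono (rect_le_iff.2 (by
        rw [rect_apply, if_pos (by omega)]; omega)) h)
      (fun a b a' b' ha _ h h' => rect_eq_zero_inf ha h h') hne
    refine ⟨x, y, witt_ext fun l => ?_⟩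
    rw [hookHom_monomialSymm]
    constructor
    · intro h
      obtain ⟨k, hk⟩ := exists_rect_eq_zero h
      obtain ⟨b, hb⟩ : ∃ b, l.1 k = b + 1 := by
        refine Nat.exists_eq_succ_of_ne_zero fun h0 => ?_
        rw [h0, rect_zero_right, monomialSymm_zeroPart, map_one] at hk
        exact one_ne_zero hk
      rw [hb] at hk
      obtain ⟨h1, h2⟩ := (hxy k b).1 hk
      have := l.2 h1
      omega
    · intro h
      exact witt_monomialSymm_mono (rect_le_iff.2 h) ((hxy x y).2 ⟨le_rfl, le_rfl⟩)
  · left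
    push Not at hne
    refine witt_ext fun l => ⟨fun h => ?_, fun h => ?_⟩
    · obtain ⟨k, hk⟩ := exists_rect_eq_zero h
      rcases Nat.eq_zero_or_eq_succ_pred (l.1 k) with h0 | h0
      · rw [h0, rect_zero_right, monomialSymm_zeroPart, map_one] at hk
        exact absurd hk one_ne_zero
      · rw [h0] at hk
        exact absurd hk (hne _ _)
    · rw [topHom_monomialSymm] at h
      exact absurd h one_ne_zero

/-- The homomorphism `Λ_ℕ → B` with given coordinates. -/
noncomputable def wittOfCoord : WithTop (ℕ × ℕ) → Witt BoolSemiring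
  | ⊤ => topHom
  | ((x, y) : ℕ × ℕ) => hookHom x y

theorem wittOfCoord_bijective : Function.Bijective wittOfCoord := by
  have hrect : ∀ x y a b, hookHom x y (monomialSymm (rect (a + 1) (b + 1))) = 0 ↔
      x ≤ a ∧ y ≤ b := fun x y a b => by
    rw [hookHom_monomialSymm, rect_apply]
    split_ifs <;> omega
  have htop : ∀ x y, hookHom x y ≠ topHom := fun x y h => by
    have := (hrect x y x y).2 ⟨le_rfl, le_rfl⟩
    rw [h, topHom_monomialSymm] at this
    exact one_ne_zero this
  constructor
  · intro u v h
    induction u with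
    | top => induction v with
      | top => rfl
      | coe v => exact absurd h.symm (htop _ _)
    | coe u => induction v with
      | top => exact absurd h (htop _ _)
      | coe v =>
        obtain ⟨x, y⟩ := u
        obtain ⟨x', y'⟩ := v
        change hookHom x y = hookHom x' y' at h
        have h1 := hrect x y x y
        rw [h, hrect] at h1
        have h2 := hrect x' y' x' y'
        rw [← h, hrect] at h2
        have hx : x = x' := by omega
        have hy : y = y' := by omega
        rw [hx, hy]
  · intro w
    rcases witt_classification w with rfl | ⟨x, y, rfl⟩
    · exact ⟨⊤, rfl⟩
    · exact ⟨((x, y) : ℕ × ℕ), rfl⟩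

/-! Plethysm with a fixed right argument is a semiring homomorphism. -/

theorem coeff_plethysm (f g : SymmFunc) (c : ℕ →₀ ℕ) :
    MvPowerSeries.coeff c (plethysm f g).1 =
      ∑ᶠ α ∈ plethysmIndex g.1 c, MvPowerSeries.coeff (α.mapDomain enum) f.1 := rfl

theorem coeff_plethysm_eq_sum (f g : SymmFunc) (c : ℕ →₀ ℕ) :
    MvPowerSeries.coeff c (plethysm f g).1 =
      ∑ α ∈ (plethysmCoeff_finite f g c).toFinset, MvPowerSeries.coeff (α.mapDomain enum) f.1 := by
  rw [coeff_plethysm]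
  refine finsum_mem_eq_sum_of_inter_support_eq _ ?_
  ext α
  simp only [Set.mem_inter_iff, Function.mem_support, Set.Finite.coe_toFinset,
    Set.mem_ofPred_eq]
  tauto

theorem coeff_plethysm_ne_zero {f g : SymmFunc} {c : ℕ →₀ ℕ} :
    MvPowerSeries.coeff c (plethysm f g).1 ≠ 0 ↔
      ∃ α ∈ plethysmIndex g.1 c, MvPowerSeries.coeff (α.mapDomain enum) f.1 ≠ 0 := by
  rw [coeff_plethysm_eq_sum, ne_eq, Finset.sum_eq_zero_iff]
  simp only [Set.Finite.mem_toFinset, Set.mem_ofPred_eq]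
  push Not
  simp only [and_assoc, and_self]

/-- The monomials of `g`, with multiplicities, over `ℤ`. -/
noncomputable def monomialFamily (g : MvPowerSeries ℕ ℕ) (s : ℕ) : MvPowerSeries ℕ ℤ :=
  if (enum.symm s).2 < MvPowerSeries.coeff (enum.symm s).1 g then
    MvPowerSeries.monomial (enum.symm s).1 1 else 0

theorem hasSubst_monomialFamily {g : MvPowerSeries ℕ ℕ} (hg : MvPowerSeries.coeff 0 g = 0) :
    MvPowerSeries.HasSubst (monomialFamily g) where
  const_coeff s := by
    classical
    have : MvPowerSeries.constantCoeff (monomialFamily g s) = 0 := by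
      rw [← MvPowerSeries.coeff_zero_eq_constantCoeff_apply, monomialFamily]
      split_ifs with h
      · rw [MvPowerSeries.coeff_monomial, if_neg]
        intro h0
        rw [← h0, hg] at h
        omega
      · simp
    rw [this]
    exact IsNilpotent.zero
  coeff_zero d := by
    classical
    refine (((Finset.range (MvPowerSeries.coeff d g)).image
      fun k => enum (d, k)).finite_toSet).subset fun s hs => ?_
    change MvPowerSeries.coeff d (monomialFamily g s) ≠ 0 at hs
    rw [monomialFamily] at hs
    split_ifs at hs with h
    · rw [MvPowerSeries.coeff_monomial] at hs
      have hd : d = (enum.symm s).1 := by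
        by_contra h0
        simp [h0] at hs
      simp only [Finset.coe_image, Set.mem_image, Finset.mem_coe, Finset.mem_range]
      refine ⟨(enum.symm s).2, by rwa [hd], ?_⟩
      rw [hd, Prod.mk.eta, Equiv.apply_symm_apply]
    · simp at hs

theorem coeff_prod_monomialFamily (g : MvPowerSeries ℕ ℕ) (c : ℕ →₀ ℕ)
    (α : ((ℕ →₀ ℕ) × ℕ) →₀ ℕ) [Decidable (α ∈ plethysmIndex g c)] :
    MvPowerSeries.coeff c ((α.mapDomain enum).prod fun s e => monomialFamily g s ^ e) =
      if α ∈ plethysmIndex g c then 1 else 0 := by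
  classical
  rw [Finsupp.prod_mapDomain_index_inj enum.injective]
  by_cases h : ∀ q ∈ α.support, q.2 < MvPowerSeries.coeff q.1 g
  · have h1 : (α.prod fun q e => monomialFamily g (enum q) ^ e) =
        MvPowerSeries.monomial (α.sum fun q m => m • q.1) 1 := by
      rw [Finsupp.prod, Finsupp.sum]
      rw [Finset.prod_congr rfl fun q hq => by
        rw [monomialFamily, Equiv.symm_apply_apply, if_pos (h q hq),
          MvPowerSeries.monomial_pow, one_pow]]
      rw [MvPowerSeries.prod_monomial]
      simp
    rw [h1, MvPowerSeries.coeff_monomial]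
    have : α ∈ plethysmIndex g c ↔ c = α.sum fun q m => m • q.1 :=
      ⟨fun h => h.2.symm, fun h' => ⟨h, h'.symm⟩⟩
    simp only [this]
  · rw [if_neg fun h' => h h'.1]
    push Not at h
    obtain ⟨q, hq, hlt⟩ := h
    rw [Finsupp.prod, Finset.prod_eq_zero hq, map_zero]
    rw [monomialFamily, Equiv.symm_apply_apply, if_neg (not_lt.2 hlt)]
    exact zero_pow (Finsupp.mem_support_iff.1 hq)

/-- Over ℤ, plethysm is substitution of the monomials of g into f, so compatibility with sums and
products is inherited from substitution. A zero constant term of g makes the substitution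
admissible. -/
theorem map_plethysm (f : SymmFunc) {g : SymmFunc} (hg : MvPowerSeries.coeff 0 g.1 = 0) :
    MvPowerSeries.map (Nat.castRingHom ℤ) (plethysm f g).1 =
      MvPowerSeries.subst (monomialFamily g.1)
        (MvPowerSeries.map (Nat.castRingHom ℤ) f.1) := by
  classical
  ext c
  rw [MvPowerSeries.coeff_subst (hasSubst_monomialFamily hg), MvPowerSeries.coeff_map,
    coeff_plethysm_eq_sum]
  let t : (((ℕ →₀ ℕ) × ℕ) →₀ ℕ) ≃ (ℕ →₀ ℕ) :=
    (Finsupp.domCongr enum : _ ≃+ (ℕ →₀ ℕ)).toEquiv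
  have ht : ∀ α, t α = α.mapDomain enum := fun α => by
    simp [t, Finsupp.equivMapDomain_eq_mapDomain]
  rw [← finsum_comp_equiv t]
  simp only [ht, coeff_prod_monomialFamily, smul_eq_mul, MvPowerSeries.coeff_map, mul_ite,
    mul_one, mul_zero]
  rw [map_sum]
  symm
  rw [finsum_eq_sum_of_support_subset (s := (plethysmCoeff_finite f g c).toFinset)]
  · refine Finset.sum_congr rfl fun α hα => ?_
    rw [Set.Finite.mem_toFinset] at hα
    rw [if_pos hα.1]
  · intro α hα
    rw [Function.mem_support, ne_eq, ite_eq_right_iff] at hα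
    push Not at hα
    rw [Set.Finite.coe_toFinset]
    exact ⟨hα.1, fun h => hα.2 (by rw [h, map_zero])⟩

theorem map_castRingHom_injective :
    Function.Injective (MvPowerSeries.map (σ := ℕ) (Nat.castRingHom ℤ)) := fun f g h => by
  ext c
  have := congrArg (MvPowerSeries.coeff c) h
  simpa [MvPowerSeries.coeff_map] using this

/-- Plethysm `f ↦ f ∘ g` as a homomorphism of semirings. -/
noncomputable def plethysmHom (g : SymmFunc) (hg : MvPowerSeries.coeff 0 g.1 = 0) :
    SymmFunc →+* SymmFunc where
  toFun f := plethysm f g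
  map_one' := Subtype.ext <| map_castRingHom_injective <| by
    rw [map_plethysm _ hg, ← MvPowerSeries.coe_substAlgHom (hasSubst_monomialFamily hg)]
    exact (congrArg _ (map_one _)).trans ((map_one _).trans (map_one _).symm)
  map_zero' := Subtype.ext <| map_castRingHom_injective <| by
    rw [map_plethysm _ hg, ← MvPowerSeries.coe_substAlgHom (hasSubst_monomialFamily hg)]
    exact (congrArg _ (map_zero _)).trans ((map_zero _).trans (map_zero _).symm)
  map_add' f₁ f₂ := Subtype.ext <| map_castRingHom_injective <| by
    change _ = MvPowerSeries.map _ ((plethysm f₁ g).1 + (plethysm f₂ g).1)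
    rw [map_add, map_plethysm _ hg, map_plethysm _ hg, map_plethysm _ hg,
      ← MvPowerSeries.subst_add (hasSubst_monomialFamily hg), ← map_add]
    rfl
  map_mul' f₁ f₂ := Subtype.ext <| map_castRingHom_injective <| by
    change _ = MvPowerSeries.map _ ((plethysm f₁ g).1 * (plethysm f₂ g).1)
    rw [map_mul, map_plethysm _ hg, map_plethysm _ hg, map_plethysm _ hg,
      ← MvPowerSeries.subst_mul (hasSubst_monomialFamily hg), ← map_mul]
    rfl

theorem coeff_zero_plethysm {f g : SymmFunc} (hf : MvPowerSeries.coeff 0 f.1 = 0)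
    (hg : MvPowerSeries.coeff 0 g.1 = 0) : MvPowerSeries.coeff 0 (plethysm f g).1 = 0 := by
  by_contra h
  obtain ⟨α, ⟨h1, h2⟩, h3⟩ := coeff_plethysm_ne_zero.1 h
  obtain ⟨q, hq⟩ : ∃ q, q ∈ α.support := by
    by_contra! h0
    rw [Finsupp.support_eq_empty.1 (Finset.eq_empty_of_forall_notMem h0),
      Finsupp.mapDomain_zero] at h3
    exact h3 hf
  have h4 : α q • q.1 = 0 := by
    rw [Finsupp.sum, Finset.sum_eq_zero_iff] at h2
    exact h2 q hq
  rw [smul_eq_zero, or_iff_right (Finsupp.mem_support_iff.1 hq)] at h4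
  have h5 := h1 q hq
  rw [h4, hg] at h5
  omega

/-! Plethysm with power sums. -/

theorem exists_perm_eq_on (s : Finset ℕ) {e : ℕ → ℕ} (he : Function.Injective e) :
    ∃ σ : Equiv.Perm ℕ, ∀ i ∈ s, σ i = e i := by
  induction s using Finset.induction_on with
  | empty => exact ⟨1, by simp⟩
  | insert a s ha ih =>
    obtain ⟨σ, hσ⟩ := ih
    refine ⟨σ.trans (Equiv.swap (σ a) (e a)), fun i hi => ?_⟩
    rw [Equiv.trans_apply]
    rcases Finset.mem_insert.1 hi with rfl | hi
    · exact Equiv.swap_apply_left _ _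
    · have hia : i ≠ a := fun h => ha (h ▸ hi)
      rw [Equiv.swap_apply_of_ne_of_ne (σ.injective.ne hia), hσ i hi]
      rw [hσ i hi]
      exact he.ne hia

/-- On a finite support an injection agrees with a permutation. This is needed because the variables
standing for the x_i^n are only some of the enumerated variables. -/
theorem coeff_mapDomain_injective (f : SymmFunc) {e : ℕ → ℕ} (he : Function.Injective e)
    (c : ℕ →₀ ℕ) : MvPowerSeries.coeff (c.mapDomain e) f.1 = MvPowerSeries.coeff c f.1 := by
  obtain ⟨σ, hσ⟩ := exists_perm_eq_on c.support he
  rw [← f.2.1 σ c, Finsupp.mapDomain_congr hσ]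

theorem coeff_powerSum_ne_zero {n : ℕ} {c : ℕ →₀ ℕ} :
    MvPowerSeries.coeff c (powerSum n).1 ≠ 0 ↔ ∃ i, c = Finsupp.single i n := by
  classical
  rw [coeff_powerSum]
  simp

theorem coeff_zero_powerSum {n : ℕ} (hn : n ≠ 0) :
    MvPowerSeries.coeff 0 (powerSum n).1 = 0 := by
  by_contra h
  obtain ⟨i, hi⟩ := coeff_powerSum_ne_zero.1 h
  have := congrArg (fun c => c i) hi
  simp at this
  exact hn this.symm

theorem mapDomain_enum_eq_single {α : ((ℕ →₀ ℕ) × ℕ) →₀ ℕ} {i n : ℕ} :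
    α.mapDomain enum = Finsupp.single i n ↔ α = Finsupp.single (enum.symm i) n := by
  rw [← (Finsupp.mapDomain_injective enum.injective).eq_iff, Finsupp.mapDomain_single,
    Equiv.apply_symm_apply]

theorem single_mem_plethysmIndex {g : MvPowerSeries ℕ ℕ} {n : ℕ} (hn : n ≠ 0)
    {q : (ℕ →₀ ℕ) × ℕ} {c : ℕ →₀ ℕ} :
    Finsupp.single q n ∈ plethysmIndex g c ↔
      q.2 < MvPowerSeries.coeff q.1 g ∧ n • q.1 = c := by
  have h : (Finsupp.single q n).support = {q} := Finsupp.support_single q hn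
  rw [plethysmIndex, Set.mem_ofPred_eq, h, Finsupp.sum_single_index (zero_smul ℕ q.1)]
  simp only [Finset.mem_singleton, forall_eq]

theorem coeff_powerSum_plethysm {n : ℕ} (hn : n ≠ 0) (f : SymmFunc) (c : ℕ →₀ ℕ) :
    MvPowerSeries.coeff (n • c) (plethysm (powerSum n) f).1 = MvPowerSeries.coeff c f.1 := by
  classical
  let t : Finset (((ℕ →₀ ℕ) × ℕ) →₀ ℕ) :=
    (Finset.range (MvPowerSeries.coeff c f.1)).image fun k => Finsupp.single (c, k) n
  have ht : ∀ α, α ∈ t ↔ ∃ k < MvPowerSeries.coeff c f.1, Finsupp.single (c, k) n = α := by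
    simp [t]
  rw [coeff_plethysm, finsum_mem_eq_sum_of_inter_support_eq (t := t)]
  · rw [Finset.sum_congr rfl (g := fun _ => 1), ← Finset.card_eq_sum_ones,
      Finset.card_image_of_injective, Finset.card_range]
    · intro k k' h
      simpa [Finsupp.single_left_inj hn] using h
    · intro α hα
      obtain ⟨k, -, rfl⟩ := (ht α).1 hα
      rw [coeff_powerSum, if_pos]
      exact ⟨enum (c, k), by rw [Finsupp.mapDomain_single]⟩
  · ext α
    simp only [Set.mem_inter_iff, Finset.mem_coe, Function.mem_support]
    refine and_congr_left fun h => ?_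
    obtain ⟨i, hi⟩ := coeff_powerSum_ne_zero.1 h
    rw [mapDomain_enum_eq_single] at hi
    subst hi
    rw [single_mem_plethysmIndex hn, ht]
    constructor
    · rintro ⟨h1, h2⟩
      have h3 : (enum.symm i).1 = c := by
        ext k
        have := congrArg (fun c => c k) h2
        simpa [hn] using this
      refine ⟨(enum.symm i).2, by rwa [← h3], ?_⟩
      rw [← h3, Prod.mk.eta]
    · rintro ⟨k, hk, h⟩
      rw [Finsupp.single_left_inj hn] at h
      rw [← h]
      exact ⟨hk, rfl⟩

theorem exists_eq_smul_of_coeff_powerSum_plethysm {n : ℕ} (hn : n ≠ 0) {f : SymmFunc}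
    {c : ℕ →₀ ℕ} (h : MvPowerSeries.coeff c (plethysm (powerSum n) f).1 ≠ 0) :
    ∃ a, c = n • a := by
  obtain ⟨α, h1, h2⟩ := coeff_plethysm_ne_zero.1 h
  obtain ⟨i, hi⟩ := coeff_powerSum_ne_zero.1 h2
  rw [mapDomain_enum_eq_single] at hi
  subst hi
  exact ⟨_, ((single_mem_plethysmIndex hn).1 h1).2.symm⟩

/-- The variable `(e, k)` for `x_i ^ n`. -/
noncomputable def powerVar (n i : ℕ) : (ℕ →₀ ℕ) × ℕ := (Finsupp.single i n, 0)

theorem powerVar_injective {n : ℕ} (hn : n ≠ 0) : Function.Injective (powerVar n) := fun i j h => by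
  simpa [powerVar, Finsupp.single_left_inj hn] using h

theorem sum_mapDomain_powerVar {n : ℕ} (hn : n ≠ 0) (a : ℕ →₀ ℕ) :
    ((a.mapDomain (powerVar n)).sum fun q m => m • q.1) = n • a := by
  rw [Finsupp.sum_mapDomain_index_inj (powerVar_injective hn)]
  ext k
  simp only [powerVar, Finsupp.sum, Finsupp.finsetSum_apply, Finsupp.smul_apply, smul_eq_mul,
    Finsupp.single_apply, mul_ite, mul_zero, Finset.sum_ite_eq', Finsupp.mem_support_iff]
  split_ifs with h
  · exact mul_comm _ _
  · rw [not_not] at h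
    rw [h, mul_zero]

theorem mem_plethysmIndex_powerSum {n : ℕ} (hn : n ≠ 0) {c : ℕ →₀ ℕ}
    {α : ((ℕ →₀ ℕ) × ℕ) →₀ ℕ} :
    α ∈ plethysmIndex (powerSum n).1 c ↔ ∃ a, α = a.mapDomain (powerVar n) ∧ n • a = c := by
  classical
  constructor
  · rintro ⟨h1, h2⟩
    have h3 : (α.support : Set _) ⊆ Set.range (powerVar n) := by
      intro q hq
      have h4 := h1 q hq
      rw [coeff_powerSum] at h4
      split_ifs at h4 with h5
      · obtain ⟨i, hi⟩ := h5
        exact ⟨i, Prod.ext hi.symm (Nat.lt_one_iff.1 h4).symm⟩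
      · omega
    refine ⟨α.comapDomain (powerVar n) (powerVar_injective hn).injOn,
      (Finsupp.mapDomain_comapDomain _ (powerVar_injective hn) _ h3).symm, ?_⟩
    rw [← sum_mapDomain_powerVar hn, Finsupp.mapDomain_comapDomain _ (powerVar_injective hn) _ h3,
      h2]
  · rintro ⟨a, rfl, rfl⟩
    refine ⟨fun q hq => ?_, sum_mapDomain_powerVar hn a⟩
    obtain ⟨i, -, rfl⟩ := Finset.mem_image.1 (Finsupp.mapDomain_support hq)
    rw [coeff_powerSum, if_pos ⟨i, rfl⟩]
    exact Nat.zero_lt_one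

theorem coeff_plethysm_powerSum {n : ℕ} (hn : n ≠ 0) (f : SymmFunc) (c : ℕ →₀ ℕ) :
    MvPowerSeries.coeff (n • c) (plethysm f (powerSum n)).1 = MvPowerSeries.coeff c f.1 := by
  have : plethysmIndex (powerSum n).1 (n • c) = {c.mapDomain (powerVar n)} := by
    ext α
    rw [mem_plethysmIndex_powerSum hn, Set.mem_singleton_iff]
    constructor
    · rintro ⟨a, rfl, h⟩
      have : a = c := by
        ext k
        have := congrArg (fun c => c k) h
        simpa [hn] using this
      rw [this]
    · rintro rfl
      exact ⟨c, rfl, rfl⟩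
  rw [coeff_plethysm, this, finsum_mem_singleton, ← Finsupp.mapDomain_comp]
  exact coeff_mapDomain_injective f (enum.injective.comp (powerVar_injective hn)) c

theorem exists_eq_smul_of_coeff_plethysm_powerSum {n : ℕ} (hn : n ≠ 0) {f : SymmFunc}
    {c : ℕ →₀ ℕ} (h : MvPowerSeries.coeff c (plethysm f (powerSum n)).1 ≠ 0) :
    ∃ a, c = n • a := by
  obtain ⟨α, h1, -⟩ := coeff_plethysm_ne_zero.1 h
  obtain ⟨a, -, ha⟩ := (mem_plethysmIndex_powerSum hn).1 h1
  exact ⟨a, ha.symm⟩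

theorem eq_plethysm_powerSum {n : ℕ} (hn : n ≠ 0) {f g : SymmFunc}
    (h1 : ∀ c, MvPowerSeries.coeff (n • c) g.1 = MvPowerSeries.coeff c f.1)
    (h2 : ∀ c, MvPowerSeries.coeff c g.1 ≠ 0 → ∃ a, c = n • a) :
    g = plethysm f (powerSum n) := by
  refine Subtype.ext (MvPowerSeries.ext fun c => ?_)
  by_cases hc : ∃ a, c = n • a
  · obtain ⟨a, rfl⟩ := hc
    rw [h1, coeff_plethysm_powerSum hn]
  · rw [not_not.1 fun h => hc (h2 c h),
      not_not.1 fun h => hc (exists_eq_smul_of_coeff_plethysm_powerSum hn h)]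

/-- Both sides raise every monomial of f to its n-th power. -/
theorem powerSum_plethysm {n : ℕ} (hn : n ≠ 0) (f : SymmFunc) :
    plethysm (powerSum n) f = plethysm f (powerSum n) :=
  eq_plethysm_powerSum hn (coeff_powerSum_plethysm hn f)
    fun _ => exists_eq_smul_of_coeff_powerSum_plethysm hn

theorem plethysm_powerSum_one (f : SymmFunc) : plethysm f (powerSum 1) = f :=
  (eq_plethysm_powerSum one_ne_zero (fun c => by rw [one_smul])
    fun c _ => ⟨c, (one_smul _ c).symm⟩).symm

theorem plethysm_plethysm_powerSum {m n : ℕ} (hm : m ≠ 0) (hn : n ≠ 0) (f : SymmFunc) :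
    plethysm (plethysm f (powerSum m)) (powerSum n) = plethysm f (powerSum (m * n)) := by
  refine eq_plethysm_powerSum (mul_ne_zero hm hn) (fun c => ?_) fun c hc => ?_
  · rw [mul_comm, mul_smul, coeff_plethysm_powerSum hn, coeff_plethysm_powerSum hm]
  · obtain ⟨a, rfl⟩ := exists_eq_smul_of_coeff_plethysm_powerSum hn hc
    rw [coeff_plethysm_powerSum hn] at hc
    obtain ⟨b, rfl⟩ := exists_eq_smul_of_coeff_plethysm_powerSum hm hc
    exact ⟨b, by rw [mul_comm, mul_smul]⟩

theorem powerSum_plethysm_powerSum {m n : ℕ} (hm : m ≠ 0) (hn : n ≠ 0) :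
    plethysm (powerSum m) (powerSum n) = powerSum (m * n) := by
  rw [← plethysm_powerSum_one (powerSum m), powerSum_plethysm hm,
    plethysm_plethysm_powerSum hm hn, powerSum_plethysm one_ne_zero, plethysm_powerSum_one]

theorem plethysmPow_powerSum {n : ℕ} (hn : n ≠ 0) (j : ℕ) :
    plethysmPow (powerSum n) j = powerSum (n ^ j) := by
  induction j with
  | zero => rfl
  | succ j ih =>
    change plethysm _ (plethysmPow _ j) = _
    rw [ih, powerSum_plethysm_powerSum hn (pow_ne_zero j hn), pow_succ']

/-! The `p`-typical symmetric functions. -/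

section PTypical

variable (p : ℕ) [Fact p.Prime]

theorem prime_pow_ne_zero (j : ℕ) : p ^ j ≠ 0 := pow_ne_zero j (Fact.out : p.Prime).ne_zero

theorem dTypical_eq (i j : ℕ) :
    dTypical p i j = plethysm (plethysmPow (dSymm p) i) (powerSum (p ^ j)) := by
  rw [dTypical, plethysmPow_powerSum (Fact.out : p.Prime).ne_zero]

theorem dTypical_zero_left (j : ℕ) : dTypical p 0 j = powerSum (p ^ j) := by
  rw [dTypical_eq, plethysmPow, powerSum_plethysm one_ne_zero, plethysm_powerSum_one]

theorem coeff_zero_dSymm : MvPowerSeries.coeff 0 (dSymm p).1 = 0 := by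
  change (MvPowerSeries.coeff 0 ((powerSum 1).1 ^ p) - _) / p = 0
  rw [MvPowerSeries.coeff_zero_eq_constantCoeff_apply, map_pow,
    ← MvPowerSeries.coeff_zero_eq_constantCoeff_apply, coeff_zero_powerSum one_ne_zero,
    zero_pow (Fact.out : p.Prime).ne_zero]
  simp

theorem coeff_zero_plethysmPow_dSymm (i : ℕ) :
    MvPowerSeries.coeff 0 (plethysmPow (dSymm p) i).1 = 0 := by
  induction i with
  | zero => exact coeff_zero_powerSum one_ne_zero
  | succ i ih => exact coeff_zero_plethysm (coeff_zero_dSymm p) ih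

/-- Apply the homomorphism (−) ∘ d^{∘i} to ψ_1^p = p d + ψ_p and commute ψ_p past d^{∘i}. -/
theorem plethysmPow_dSymm_pow (i : ℕ) :
    plethysmPow (dSymm p) i ^ p = p • plethysmPow (dSymm p) (i + 1) +
      plethysm (plethysmPow (dSymm p) i) (powerSum p) := by
  have h := congrArg (plethysmHom _ (coeff_zero_plethysmPow_dSymm p i)) (powerSum_one_pow p)
  rw [map_pow, map_add, map_nsmul] at h
  change plethysm _ _ ^ p = p • plethysm _ _ + plethysm _ _ at h
  rwa [powerSum_plethysm one_ne_zero, plethysm_powerSum_one,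
    powerSum_plethysm (Fact.out : p.Prime).ne_zero] at h

theorem dTypical_pow (i j : ℕ) :
    dTypical p i j ^ p = p • dTypical p (i + 1) j + dTypical p i (j + 1) := by
  have h := congrArg (plethysmHom _ (coeff_zero_powerSum (prime_pow_ne_zero p j)))
    (plethysmPow_dSymm_pow p i)
  rw [map_pow, map_add, map_nsmul] at h
  change plethysm _ _ ^ p = p • plethysm _ _ + plethysm _ _ at h
  rw [plethysm_plethysm_powerSum (Fact.out : p.Prime).ne_zero (prime_pow_ne_zero p j)] at h
  rw [dTypical_eq, dTypical_eq, dTypical_eq, h, pow_succ']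

theorem dGen_pow (i j : ℕ) : dGen p i j ^ p = p • dGen p (i + 1) j + dGen p i (j + 1) :=
  Subtype.ext (dTypical_pow p i j)

end PTypical

/-! Algebraic independence of the power sums. -/

theorem aeval_chain_rule {ι K A : Type*} [Fintype ι] [CommRing K] [CommRing A] [Algebra K A]
    (D : Derivation K A A) (g : ι → A) (F : MvPolynomial ι K) :
    D (MvPolynomial.aeval g F) =
      ∑ j, MvPolynomial.aeval g (MvPolynomial.pderiv j F) * D (g j) := by
  classical
  induction F using MvPolynomial.induction_on with
  | C a => simp
  | add F G hF hG => simp only [map_add, hF, hG, add_mul, Finset.sum_add_distrib]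
  | mul_X F k hF =>
    simp only [map_mul, MvPolynomial.aeval_X, Derivation.leibniz, hF, MvPolynomial.pderiv_X,
      smul_eq_mul, map_add, add_mul, Finset.sum_add_distrib, Finset.mul_sum]
    congr 1
    · rw [Finset.sum_eq_single k]
      · simp
      · intro j _ hj
        simp [Pi.single_eq_of_ne' hj]
      · simp
    · refine Finset.sum_congr rfl fun j _ => ?_
      ring

/-- The power sum `ψ_n` with real coefficients. -/
noncomputable def realPowerSum (n : ℕ) : MvPowerSeries ℕ ℝ :=
  MvPowerSeries.map (Nat.castRingHom ℝ) (powerSum n).1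

theorem pderiv_realPowerSum {n : ℕ} (hn : n ≠ 0) (i : ℕ) :
    MvPowerSeries.pderiv ℝ i (realPowerSum n) = (n : ℝ) • MvPowerSeries.X i ^ (n - 1) := by
  classical
  ext c
  rw [MvPowerSeries.coeff_pderiv, realPowerSum, MvPowerSeries.coeff_map, coeff_powerSum,
    map_smul, MvPowerSeries.coeff_X_pow]
  by_cases h : c = Finsupp.single i (n - 1)
  · have h1 : c + Finsupp.single i 1 = Finsupp.single i n := by
      rw [h, ← Finsupp.single_add, Nat.sub_add_cancel (Nat.one_le_iff_ne_zero.2 hn)]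
    have h2 : ((n - 1 : ℕ) : ℝ) + 1 = n := by
      exact_mod_cast congrArg (Nat.cast (R := ℝ)) (Nat.succ_pred_eq_of_ne_zero hn)
    rw [if_pos h, if_pos ⟨i, h1⟩, h]
    simp [h2]
  · rw [if_neg h, if_neg]
    · simp
    · rintro ⟨k, hk⟩
      have hki : k = i := by
        by_contra hne
        have := congrArg (fun c => c i) hk
        simp [Finsupp.single_eq_of_ne' hne] at this
      subst hki
      refine h (Finsupp.ext fun j => ?_)
      have := congrArg (fun c => c j) hk
      simp only [Finsupp.add_apply, Finsupp.single_apply] at this ⊢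
      split_ifs at this ⊢ <;> omega

/-- A Jacobian argument, by induction on a degree bound for a relation F. Differentiating in x_i
gives Σ_j (∂_j F)(ψ) e_j x_i^{e_j − 1} = 0 for every i. As the exponents e_j are distinct, each ∂_j
F is a relation of smaller degree, hence zero, and F is constant. -/
theorem algebraicIndependent_realPowerSum_of_fintype {ι : Type*} [Fintype ι] {e : ι → ℕ}
    (he : Function.Injective e) (he0 : ∀ i, e i ≠ 0) :
    AlgebraicIndependent ℝ fun i => realPowerSum (e i) := by
  classical
  rw [algebraicIndependent_iff]
  suffices ∀ (d : ℕ) (F : MvPolynomial ι ℝ), (∀ m, F.coeff m ≠ 0 → m.degree < d) →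
      MvPolynomial.aeval (fun i => realPowerSum (e i)) F = 0 → F = 0 from fun F hF =>
    this (F.totalDegree + 1) F (fun m hm => Nat.lt_succ_of_le
      (MvPolynomial.le_totalDegree (MvPolynomial.mem_support_iff.2 hm))) hF
  intro d
  induction d with
  | zero =>
    intro F hF _
    ext m
    by_contra hm
    exact absurd (hF m hm) (Nat.not_lt_zero _)
  | succ d ih =>
    intro F hF h0
    have : IsDomain (MvPowerSeries ℕ ℝ) := NoZeroDivisors.to_isDomain _
    set g : ι → MvPowerSeries ℕ ℝ := fun i => realPowerSum (e i)
    let Q : Polynomial (MvPowerSeries ℕ ℝ) := ∑ j, Polynomial.monomial (e j - 1)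
      (MvPolynomial.aeval g (MvPolynomial.pderiv j F) * ((e j : ℝ) • 1))
    -- Q is one polynomial over a domain, with the infinitely many distinct roots x_0, x_1, ….
    have hQ : Q = 0 := by
      refine Polynomial.eq_zero_of_infinite_isRoot Q (Set.infinite_of_injective_forall_mem
        (f := fun i : ℕ => (MvPowerSeries.X i : MvPowerSeries ℕ ℝ))
        (fun i j hij => MvPowerSeries.X_inj.1 hij) fun i => ?_)
      have h1 := aeval_chain_rule (MvPowerSeries.pderiv ℝ i) g F
      rw [h0, map_zero] at h1
      change Polynomial.eval _ Q = 0
      rw [Polynomial.eval_finsetSum, h1]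
      refine Finset.sum_congr rfl fun j _ => ?_
      rw [Polynomial.eval_monomial, pderiv_realPowerSum (he0 j), mul_assoc, smul_mul_assoc,
        one_mul]
    have hder : ∀ k, MvPolynomial.pderiv k F = 0 := by
      intro k
      refine ih _ (fun m hm => ?_) ?_
      · rw [MvPolynomial.coeff_pderiv] at hm
        have := hF _ (left_ne_zero_of_mul hm)
        rw [map_add, Finsupp.degree_single] at this
        omega
      · have h1 := congrArg (fun Q => Polynomial.coeff Q (e k - 1)) hQ
        simp only [Q, Polynomial.finsetSum_coeff, Polynomial.coeff_monomial,
          Polynomial.coeff_zero] at h1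
        rw [Finset.sum_eq_single k] at h1
        · rw [if_pos rfl, mul_smul_comm, mul_one, smul_eq_zero, or_iff_right] at h1
          · exact h1
          · exact_mod_cast he0 k
        · intro j _ hj
          rw [if_neg]
          intro h
          have h2 := he0 j
          have h3 := he0 k
          exact hj (he (by omega))
        · simp
    have hC : F = MvPolynomial.C (F.coeff 0) := by
      ext m
      rw [MvPolynomial.coeff_C]
      split_ifs with hm
      · rw [← hm]
      · obtain ⟨k, hk⟩ : ∃ k, m k ≠ 0 := by
          by_contra! h
          exact hm (Finsupp.ext fun k => (h k).symm)
        have h1 := congrArg (MvPolynomial.coeff (m - Finsupp.single k 1)) (hder k)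
        rw [MvPolynomial.coeff_pderiv, MvPolynomial.coeff_zero, mul_eq_zero] at h1
        have h2 : m - Finsupp.single k 1 + Finsupp.single k 1 = m :=
          tsub_add_cancel_of_le (by
            rw [Finsupp.single_le_iff]
            omega)
        rw [h2] at h1
        refine h1.resolve_right ?_
        positivity
    rw [hC, MvPolynomial.aeval_C] at h0
    have h2 : F.coeff 0 = 0 := (algebraMap ℝ (MvPowerSeries ℕ ℝ)).injective (by rw [h0, map_zero])
    rw [hC, h2, map_zero]

theorem algebraicIndependent_realPowerSum {ι : Type*} {e : ι → ℕ}
    (he : Function.Injective e) (he0 : ∀ i, e i ≠ 0) :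
    AlgebraicIndependent ℝ fun i => realPowerSum (e i) :=
  algebraicIndependent_of_finite_type fun t ht => by
    have := ht.fintype
    exact algebraicIndependent_realPowerSum_of_fintype
      (e := fun i : t => e i) (he.comp Subtype.val_injective) fun i => he0 i

/-! Real solutions of `D_{i,j}^p = p D_{i+1,j} + D_{i,j+1}`. -/

theorem three_mul_add_one_le_pow {p : ℕ} (hp : 2 ≤ p) : 3 * p + 1 ≤ 3 ^ p := by
  induction p, hp using Nat.le_induction with
  | base => norm_num
  | succ n hn ih => rw [pow_succ]; omega

/-- Solving for F (n + 1) recursively could leave the positive reals. A large start value prevents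
this: the bound F n ≥ 3 max(1, G n) propagates because G grows at most by p-th powers and 3a + b ≤
3^p. -/
theorem exists_pos_solution {p : ℕ} {a b : ℝ} (ha : 0 < a) (hb : 0 ≤ b) (hp : 1 ≤ p)
    (hab : 3 * a + b ≤ 3 ^ p) {G : ℕ → ℝ} (hG : ∀ n, G (n + 1) ≤ G n ^ p) (hG0 : ∀ n, 0 ≤ G n) :
    ∃ F : ℕ → ℝ, (∀ n, 0 < F n) ∧ ∀ n, F n ^ p = a * F (n + 1) + b * G n := by
  let F : ℕ → ℝ := fun n => n.rec (3 * max 1 (G 0)) fun k r => (r ^ p - b * G k) / a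
  have hF : ∀ n, F (n + 1) = (F n ^ p - b * G n) / a := fun n => rfl
  have hge : ∀ n, 3 * max 1 (G n) ≤ F n := by
    intro n
    induction n with
    | zero => exact le_rfl
    | succ n ih =>
      rw [hF, le_div_iff₀ ha]
      set M := max 1 (G n)
      have hM1 : 1 ≤ M := le_max_left _ _
      have h1 : max 1 (G (n + 1)) ≤ M ^ p := max_le (one_le_pow₀ hM1)
        ((hG n).trans (pow_le_pow_left₀ (hG0 n) (le_max_right _ _) p))
      have h2 : G n ≤ M ^ p := (le_max_right _ _).trans (le_self_pow₀ hM1 (by omega))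
      have h3 : (3 * M) ^ p ≤ F n ^ p := pow_le_pow_left₀ (by positivity) ih p
      rw [mul_pow] at h3
      have h4 : (3 * a + b) * M ^ p ≤ 3 ^ p * M ^ p :=
        mul_le_mul_of_nonneg_right hab (by positivity)
      have h5 := mul_le_mul_of_nonneg_left h2 hb
      have h6 := mul_le_mul_of_nonneg_left h1 ha.le
      linarith
  refine ⟨F, fun n => lt_of_lt_of_le (by positivity) (hge n), fun n => ?_⟩
  rw [hF]
  field_simp
  ring

/-- Start from the zero array and prepend positive lines, each shifting the zero quadrant by one: y
lines at j = 0, then x lines at i = 0. The relation along a new line is the recursion of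
`exists_pos_solution`, with (a, b) = (p, 1) or (1, p). The constant 3 works for all p ≥ 2 in both
cases. -/
theorem exists_real_array {p : ℕ} (hp : 2 ≤ p) (x y : ℕ) :
    ∃ D : ℕ → ℕ → ℝ, (∀ i j, 0 ≤ D i j) ∧
      (∀ i j, D i j ^ p = p * D (i + 1) j + D i (j + 1)) ∧
      ∀ i j, D i j = 0 ↔ x ≤ i ∧ y ≤ j := by
  have hpos : (0 : ℝ) < p := by positivity
  have h3 : 3 * (p : ℝ) + 1 ≤ 3 ^ p := by exact_mod_cast three_mul_add_one_le_pow hp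
  have hp2 : (2 : ℝ) ≤ p := by exact_mod_cast hp
  induction x with
  | zero =>
    induction y with
    | zero => exact ⟨fun _ _ => 0, by simp, fun i j => by simp; omega, by simp⟩
    | succ y ih =>
      obtain ⟨D, h0, hD, hz⟩ := ih
      obtain ⟨F, hF0, hF⟩ := exists_pos_solution (p := p) (a := p) (b := 1) (G := fun i => D i 0)
        hpos zero_le_one (by omega) h3 (fun i => by
          have := hD i 0
          have h1 := h0 i 1
          have h2 := h0 (i + 1) 0
          nlinarith) fun i => h0 i 0
      refine ⟨fun i j => j.casesOn (F i) fun j => D i j, fun i j => ?_, fun i j => ?_,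
        fun i j => ?_⟩
      · cases j with
        | zero => exact (hF0 i).le
        | succ j => exact h0 i j
      · cases j with
        | zero => simpa using hF i
        | succ j => exact hD i j
      · cases j with
        | zero => simpa using (hF0 i).ne'
        | succ j => simpa using hz i j
  | succ x ih =>
    obtain ⟨D, h0, hD, hz⟩ := ih
    obtain ⟨F, hF0, hF⟩ := exists_pos_solution (p := p) (a := 1) (b := p) (G := fun j => D 0 j)
      zero_lt_one hpos.le (by omega) (by linarith) (fun j => by
        have := hD 0 j
        have h1 := mul_nonneg hpos.le (h0 1 j)
        simp only [zero_add] at this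
        linarith) fun j => h0 0 j
    refine ⟨fun i j => i.casesOn (F j) fun i => D i j, fun i j => ?_, fun i j => ?_,
      fun i j => ?_⟩
    · cases i with
      | zero => exact (hF0 j).le
      | succ i => exact h0 i j
    · cases i with
      | zero => simpa [add_comm] using hF j
      | succ i => exact hD i j
    · cases i with
      | zero => simpa using (hF0 j).ne'
      | succ i => simpa using hz i j

/-! Homomorphisms `Λ_{ℕ,(p)} → ℝ`. -/

theorem nonneg_of_dGen_nonneg {p : ℕ} (v : PTypicalSymm p →+* ℝ) (h : ∀ i j, 0 ≤ v (dGen p i j))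
    (f : PTypicalSymm p) : 0 ≤ v f := by
  obtain ⟨f, hf⟩ := f
  induction hf using Subsemiring.closure_induction with
  | mem x hx =>
    obtain ⟨i, j, rfl⟩ := hx
    exact h i j
  | zero => exact (map_zero v).ge
  | one => exact zero_le_one.trans_eq (map_one v).symm
  | add f g hf hg ihf ihg => exact (add_nonneg ihf ihg).trans_eq (map_add v ⟨f, hf⟩ ⟨g, hg⟩).symm
  | mul f g hf hg ihf ihg => exact (mul_nonneg ihf ihg).trans_eq (map_mul v ⟨f, hf⟩ ⟨g, hg⟩).symm

section PTypical

variable (p : ℕ) [Fact p.Prime]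

/-- Symmetric functions as real power series. -/
noncomputable def toReal : SymmFunc →+* MvPowerSeries ℕ ℝ :=
  (MvPowerSeries.map (Nat.castRingHom ℝ)).comp SymmFunc.subtype

/-- The real algebra generated by the power sums `ψ_{p^j}`. -/
noncomputable abbrev powerSumAlgebra : Subalgebra ℝ (MvPowerSeries ℕ ℝ) :=
  Algebra.adjoin ℝ (Set.range fun j => realPowerSum (p ^ j))

theorem algebraicIndependent_prime_pow :
    AlgebraicIndependent ℝ fun j => realPowerSum (p ^ j) :=
  algebraicIndependent_realPowerSum
    (Nat.pow_right_injective (Fact.out : p.Prime).two_le) (prime_pow_ne_zero p)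

/-- Over ℝ one may divide by p: d_{i+1,j} = (d_{i,j}^p − d_{i,j+1}) / p, so every d_{i,j} is a
polynomial in the ψ_{p^k}. -/
theorem toReal_dTypical_mem (i j : ℕ) : toReal (dTypical p i j) ∈ powerSumAlgebra p := by
  induction i generalizing j with
  | zero =>
    rw [dTypical_zero_left]
    exact Algebra.subset_adjoin ⟨j, rfl⟩
  | succ i ih =>
    have h := congrArg toReal (dTypical_pow p i j)
    rw [map_pow, map_add, map_nsmul] at h
    have hp : (p : ℝ) ≠ 0 := Nat.cast_ne_zero.2 (Fact.out : p.Prime).ne_zero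
    have h1 : toReal (dTypical p (i + 1) j) =
        (p : ℝ)⁻¹ • (toReal (dTypical p i j) ^ p - toReal (dTypical p i (j + 1))) := by
      rw [h, add_sub_cancel_right, ← Nat.cast_smul_eq_nsmul ℝ, smul_smul, inv_mul_cancel₀ hp,
        one_smul]
    rw [h1]
    exact Subalgebra.smul_mem _ (Subalgebra.sub_mem _ (Subalgebra.pow_mem _ (ih j) p)
      (ih (j + 1))) _

theorem toReal_mem {f : SymmFunc} (hf : f ∈ PTypicalSymm p) : toReal f ∈ powerSumAlgebra p := by
  have : PTypicalSymm p ≤ (powerSumAlgebra p).toSubsemiring.comap toReal := by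
    refine Subsemiring.closure_le.2 ?_
    rintro _ ⟨i, j, rfl⟩
    exact toReal_dTypical_mem p i j
  exact this hf

/-- The homomorphism `Λ_{ℕ,(p)} → ℝ` with `ψ_{p^j} ↦ a_j`. -/
noncomputable def realEval (a : ℕ → ℝ) : PTypicalSymm p →+* ℝ :=
  ((MvPolynomial.aeval a).comp
    (algebraicIndependent_prime_pow p).repr : powerSumAlgebra p →ₐ[ℝ] ℝ).toRingHom.comp
    ((toReal.comp (PTypicalSymm p).subtype).codRestrict (powerSumAlgebra p).toSubsemiring
      fun f => toReal_mem p f.2)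

theorem realEval_dGen_zero (a : ℕ → ℝ) (j : ℕ) : realEval p a (dGen p 0 j) = a j := by
  have h2 : (algebraicIndependent_prime_pow p).repr
      ⟨realPowerSum (p ^ j), Algebra.subset_adjoin ⟨j, rfl⟩⟩ = MvPolynomial.X j := by
    apply (algebraicIndependent_prime_pow p)
    rw [AlgebraicIndependent.aeval_repr, MvPolynomial.aeval_X]
  have h3 : realEval p a (dGen p 0 j) = MvPolynomial.aeval a
      ((algebraicIndependent_prime_pow p).repr
        ⟨toReal (dTypical p 0 j), toReal_dTypical_mem p 0 j⟩) := rfl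
  have h4 : (⟨toReal (dTypical p 0 j), toReal_dTypical_mem p 0 j⟩ : powerSumAlgebra p) =
      ⟨realPowerSum (p ^ j), Algebra.subset_adjoin ⟨j, rfl⟩⟩ :=
    Subtype.ext (congrArg toReal (dTypical_zero_left p j))
  rw [h3, h4, h2, MvPolynomial.aeval_X]

theorem realEval_dGen {D : ℕ → ℕ → ℝ}
    (hD : ∀ i j, D i j ^ p = p * D (i + 1) j + D i (j + 1)) (i j : ℕ) :
    realEval p (D 0) (dGen p i j) = D i j := by
  induction i generalizing j with
  | zero => exact realEval_dGen_zero p _ j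
  | succ i ih =>
    have h := congrArg (realEval p (D 0)) (dGen_pow p i j)
    rw [map_pow, map_add, map_nsmul, ih, ih, hD, nsmul_eq_mul, add_left_inj] at h
    exact (mul_left_cancel₀ (Nat.cast_ne_zero.2 (Fact.out : p.Prime).ne_zero) h).symm

/-- A nonnegative real homomorphism induces a homomorphism to `B`. -/
theorem exists_bool_hom {R : Type*} [CommSemiring R] (v : R →+* ℝ) (hv : ∀ f, 0 ≤ v f) :
    ∃ w : R →+* BoolSemiring, ∀ f, w f = 0 ↔ v f = 0 := by
  classical
  have h : ∀ f, (if v f = 0 then (0 : BoolSemiring) else 1) = 0 ↔ v f = 0 := fun f => by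
    simp
  refine ⟨{ toFun := fun f => if v f = 0 then 0 else 1
            map_one' := by simp
            map_zero' := by simp
            map_add' := fun f g => BoolSemiring.eq_of_zero_iff ?_
            map_mul' := fun f g => BoolSemiring.eq_of_zero_iff ?_ }, h⟩
  · rw [mul_eq_zero, h, h, h, map_mul, mul_eq_zero]
  -- Nonnegativity enters here: without it two nonzero values could cancel.
  · rw [BoolSemiring.add_eq_zero, h, h, h, map_add, add_eq_zero_iff_of_nonneg (hv f) (hv g)]

theorem exists_pTypicalWitt (x y : ℕ) :
    ∃ w : PTypicalWitt p BoolSemiring, ∀ i j, w (dGen p i j) = 0 ↔ x ≤ i ∧ y ≤ j := by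
  obtain ⟨D, h0, hD, hz⟩ := exists_real_array (Fact.out : p.Prime).two_le x y
  obtain ⟨w, hw⟩ := exists_bool_hom (realEval p (D 0)) (nonneg_of_dGen_nonneg _
    fun i j => (h0 i j).trans_eq (realEval_dGen p hD i j).symm)
  exact ⟨w, fun i j => by rw [hw, realEval_dGen p hD, hz]⟩

end PTypical

/-! Classification of the homomorphisms `Λ_{ℕ,(p)} → B`. -/

section Classification

variable {p : ℕ}

theorem pTypicalWitt_ext {v w : PTypicalWitt p BoolSemiring}
    (h : ∀ i j, v (dGen p i j) = 0 ↔ w (dGen p i j) = 0) : v = w := by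
  refine RingHom.ext fun f => ?_
  obtain ⟨f, hf⟩ := f
  induction hf using Subsemiring.closure_induction with
  | mem x hx =>
    obtain ⟨i, j, rfl⟩ := hx
    exact BoolSemiring.eq_of_zero_iff (h i j)
  | zero => exact (map_zero v).trans (map_zero w).symm
  | one => exact (map_one v).trans (map_one w).symm
  | add f g hf hg ihf ihg =>
    exact (map_add v ⟨f, hf⟩ ⟨g, hg⟩).trans
      ((congrArg₂ (· + ·) ihf ihg).trans (map_add w ⟨f, hf⟩ ⟨g, hg⟩).symm)
  | mul f g hf hg ihf ihg =>
    exact (map_mul v ⟨f, hf⟩ ⟨g, hg⟩).trans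
      ((congrArg₂ (· * ·) ihf ihg).trans (map_mul w ⟨f, hf⟩ ⟨g, hg⟩).symm)

variable [Fact p.Prime] (w : PTypicalWitt p BoolSemiring)

/-- The relation d_{i,j}^p = p d_{i+1,j} + d_{i,j+1} read in `BoolSemiring`, where taking p-th
powers and multiplying by p do not affect vanishing. -/
theorem map_dGen_eq_zero_iff (i j : ℕ) :
    w (dGen p i j) = 0 ↔ w (dGen p (i + 1) j) = 0 ∧ w (dGen p i (j + 1)) = 0 := by
  have hp : p ≠ 0 := (Fact.out : p.Prime).ne_zero
  rw [← pow_eq_zero_iff hp, ← map_pow, dGen_pow, map_add, map_nsmul, BoolSemiring.add_eq_zero,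
    BoolSemiring.nsmul_eq_zero, or_iff_right hp]

theorem map_dGen_eq_zero_mono {i j i' j' : ℕ} (hi : i ≤ i') (hj : j ≤ j')
    (h : w (dGen p i j) = 0) : w (dGen p i' j') = 0 := by
  have h1 : w (dGen p i' j) = 0 := by
    induction i', hi using Nat.le_induction with
    | base => exact h
    | succ n _ ih => exact ((map_dGen_eq_zero_iff w n j).1 ih).1
  induction j', hj using Nat.le_induction with
  | base => exact h1
  | succ n _ ih => exact ((map_dGen_eq_zero_iff w i' n).1 ih).2

/-- Walk from the corner (i, j') by unit steps in either index. Each path ends on a point known to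
be killed, and by `map_dGen_eq_zero_iff` vanishing propagates back to the corner. -/
theorem map_dGen_eq_zero_inf {i j i' j' : ℕ} (hi : i ≤ i') (hj : j' ≤ j)
    (h : w (dGen p i j) = 0) (h' : w (dGen p i' j') = 0) : w (dGen p i j') = 0 := by
  obtain ⟨m, hm⟩ : ∃ m, m = (i' - i) + (j - j') := ⟨_, rfl⟩
  induction m generalizing i j' with
  | zero =>
    obtain rfl : j = j' := by omega
    exact h
  | succ m ih =>
    rcases hi.eq_or_lt with rfl | hi
    · exact h'
    rcases hj.eq_or_lt with rfl | hj
    · exact h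
    exact (map_dGen_eq_zero_iff w i j').2
      ⟨ih hi hj.le (map_dGen_eq_zero_mono w (Nat.le_succ i) le_rfl h) h' (by omega),
        ih hi.le hj h (map_dGen_eq_zero_mono w le_rfl (Nat.le_succ j') h') (by omega)⟩

theorem pTypicalWitt_classification :
    (∀ i j, w (dGen p i j) ≠ 0) ∨ ∃ x y, ∀ i j, w (dGen p i j) = 0 ↔ x ≤ i ∧ y ≤ j := by
  by_cases h : ∃ i j, w (dGen p i j) = 0
  · exact Or.inr (exists_principal (fun _ _ _ _ hi hj => map_dGen_eq_zero_mono w hi hj)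
      (fun _ _ _ _ hi hj => map_dGen_eq_zero_inf w hi hj) h)
  · push Not at h
    exact Or.inl h

end Classification

/-! Supports of the `d_{i,j}`. -/

theorem coeff_powerSum_one_pow_ne_zero {n : ℕ} {c : ℕ →₀ ℕ} :
    MvPowerSeries.coeff c (powerSum 1 ^ n : SymmFunc).1 ≠ 0 ↔ c.degree = n := by
  induction n generalizing c with
  | zero =>
    rw [pow_zero, Finsupp.degree_eq_zero_iff]
    exact coeff_one_ne_zero
  | succ n ih =>
    rw [pow_succ]
    refine coeff_mul_ne_zero.trans ?_
    constructor
    · rintro ⟨a, b, rfl, ha, hb⟩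
      obtain ⟨i, rfl⟩ := coeff_powerSum_ne_zero.1 hb
      rw [map_add, ih.1 ha, Finsupp.degree_single]
    · intro hc
      obtain ⟨i, hi⟩ : ∃ i, c i ≠ 0 := by
        by_contra! h0
        rw [show c = 0 from Finsupp.ext h0] at hc
        simp at hc
      have h : c - Finsupp.single i 1 + Finsupp.single i 1 = c :=
        tsub_add_cancel_of_le (by rw [Finsupp.single_le_iff]; omega)
      refine ⟨_, _, h, ih.2 ?_, coeff_powerSum_ne_zero.2 ⟨i, rfl⟩⟩
      rw [← h, map_add, Finsupp.degree_single] at hc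
      omega

theorem coeff_single_powerSum_one_pow (k n : ℕ) :
    MvPowerSeries.coeff (Finsupp.single k n) (powerSum 1 ^ n : SymmFunc).1 = 1 := by
  classical
  let e : Unit ↪ ℕ := ⟨fun _ => k, fun _ _ _ => rfl⟩
  have he : Finsupp.single k n = Finsupp.embDomain e (Finsupp.single () n) := by
    rw [Finsupp.embDomain_single]; rfl
  change MvPowerSeries.coeff _ ((powerSum 1).1 ^ n) = 1
  rw [he, ← MvPowerSeries.coeff_killCompl, map_pow, killCompl_powerSum e 1 one_ne_zero]
  simp [MvPowerSeries.coeff_X_pow]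

section Support

variable (p : ℕ) [Fact p.Prime]

theorem coeff_powerSum_one_pow_eq (c : ℕ →₀ ℕ) :
    MvPowerSeries.coeff c (powerSum 1 ^ p : SymmFunc).1 =
      p * MvPowerSeries.coeff c (dSymm p).1 + MvPowerSeries.coeff c (powerSum p).1 := by
  rw [powerSum_one_pow]
  change MvPowerSeries.coeff c (p • (dSymm p).1 + (powerSum p).1) = _
  rw [map_add, map_nsmul, smul_eq_mul]

/-- All monomials of degree p occur in (Σ x_i)^p; the pure powers occur with coefficient 1, which
ψ_p removes entirely. -/
theorem coeff_dSymm_ne_zero {c : ℕ →₀ ℕ} :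
    MvPowerSeries.coeff c (dSymm p).1 ≠ 0 ↔ c.degree = p ∧ ∀ k, c ≠ Finsupp.single k p := by
  classical
  have hp : p ≠ 0 := (Fact.out : p.Prime).ne_zero
  have h := coeff_powerSum_one_pow_eq p c
  by_cases hc : ∃ k, c = Finsupp.single k p
  · obtain ⟨k, rfl⟩ := hc
    rw [coeff_single_powerSum_one_pow, coeff_powerSum, if_pos ⟨k, rfl⟩] at h
    have h1 : p * MvPowerSeries.coeff (Finsupp.single k p) (dSymm p).1 = 0 := by omega
    rw [mul_eq_zero, or_iff_right hp] at h1
    exact ⟨fun h2 => absurd h1 h2, fun h2 => absurd rfl (h2.2 k)⟩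
  · rw [coeff_powerSum, if_neg hc, add_zero] at h
    push Not at hc
    rw [← coeff_powerSum_one_pow_ne_zero, h, mul_ne_zero_iff]
    tauto

theorem plethysmPow_one (f : SymmFunc) : plethysmPow f 1 = f := plethysm_powerSum_one f

/-- The monomial X^a Y^b is not a pure power, so it occurs in d; substitute two different monomials
of g for X and Y. -/
theorem coeff_dSymm_plethysm_ne_zero {g : SymmFunc} {u v : ℕ →₀ ℕ}
    (hu : MvPowerSeries.coeff u g.1 ≠ 0) (hv : MvPowerSeries.coeff v g.1 ≠ 0) (huv : u ≠ v)
    {a b : ℕ} (ha : a ≠ 0) (hb : b ≠ 0) (hab : a + b = p) :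
    MvPowerSeries.coeff (a • u + b • v) (plethysm (dSymm p) g).1 ≠ 0 := by
  classical
  have hne : ((u, 0) : (ℕ →₀ ℕ) × ℕ) ≠ (v, 0) := fun h => huv (congrArg Prod.fst h)
  refine coeff_plethysm_ne_zero.2
    ⟨Finsupp.single (u, 0) a + Finsupp.single (v, 0) b, ⟨fun q hq => ?_, ?_⟩, ?_⟩
  · rcases Finset.mem_union.1 (Finsupp.support_add hq) with h | h
    · rw [Finset.mem_singleton.1 (Finsupp.support_single_subset h)]
      exact Nat.pos_of_ne_zero hu
    · rw [Finset.mem_singleton.1 (Finsupp.support_single_subset h)]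
      exact Nat.pos_of_ne_zero hv
  · rw [Finsupp.sum_add_index' (fun q => zero_smul ℕ q.1) fun q m n => add_smul m n q.1,
      Finsupp.sum_single_index (zero_smul ℕ u), Finsupp.sum_single_index (zero_smul ℕ v)]
  · rw [coeff_dSymm_ne_zero]
    refine ⟨by simp [hab], fun k hk => ?_⟩
    rw [mapDomain_enum_eq_single] at hk
    have h1 := congrArg (fun α => α (u, 0)) hk
    have h2 := congrArg (fun α => α (v, 0)) hk
    simp only [Finsupp.add_apply, Finsupp.single_apply, hne, hne.symm] at h1 h2
    grind

/-- Carrying two distinct monomials makes the induction run: from u, v pass to (p − 1)u + v and u +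
(p − 1)v, which differ by (p − 2)(u − v). For p = 2 they would coincide. -/
theorem exists_two_coeff_plethysmPow_dSymm (hp : p ≠ 2) (i : ℕ) :
    ∃ u v : ℕ →₀ ℕ, u ≠ v ∧ (∀ k, 2 ≤ k → u k = 0 ∧ v k = 0) ∧
      MvPowerSeries.coeff u (plethysmPow (dSymm p) i).1 ≠ 0 ∧
      MvPowerSeries.coeff v (plethysmPow (dSymm p) i).1 ≠ 0 := by
  have hp2 := (Fact.out : p.Prime).two_le
  induction i with
  | zero =>
    refine ⟨Finsupp.single 0 1, Finsupp.single 1 1, ?_, fun k hk => ?_,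
      coeff_powerSum_ne_zero.2 ⟨0, rfl⟩, coeff_powerSum_ne_zero.2 ⟨1, rfl⟩⟩
    · simp [Finsupp.single_left_inj]
    · rw [Finsupp.single_eq_of_ne (by omega), Finsupp.single_eq_of_ne (by omega)]
      exact ⟨rfl, rfl⟩
  | succ i ih =>
    obtain ⟨u, v, huv, hk, hu, hv⟩ := ih
    refine ⟨(p - 1) • u + 1 • v, 1 • u + (p - 1) • v, fun h => huv (Finsupp.ext fun k => ?_),
      fun k hk' => ?_, coeff_dSymm_plethysm_ne_zero p hu hv huv (by omega) one_ne_zero (by omega),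
      coeff_dSymm_plethysm_ne_zero p hu hv huv one_ne_zero (by omega) (by omega)⟩
    · have h1 := congrArg (fun c => c k) h
      obtain ⟨m, rfl⟩ : ∃ m, p = m + 3 := ⟨p - 3, by omega⟩
      simp only [Finsupp.add_apply, Finsupp.smul_apply, smul_eq_mul,
        show m + 3 - 1 = m + 2 by omega] at h1
      have h2 : (m + 1) * u k = (m + 1) * v k := by linarith
      exact Nat.eq_of_mul_eq_mul_left (Nat.succ_pos m) h2
    · simp [hk k hk']

/-- For p = 2, three distinct monomials reproduce themselves as the three pairwise products. -/
theorem exists_three_coeff_plethysmPow_dSymm (i : ℕ) :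
    ∃ u v w : ℕ →₀ ℕ, u ≠ v ∧ u ≠ w ∧ v ≠ w ∧ (∀ k, 3 ≤ k → u k = 0 ∧ v k = 0 ∧ w k = 0) ∧
      MvPowerSeries.coeff u (plethysmPow (dSymm 2) i).1 ≠ 0 ∧
      MvPowerSeries.coeff v (plethysmPow (dSymm 2) i).1 ≠ 0 ∧
      MvPowerSeries.coeff w (plethysmPow (dSymm 2) i).1 ≠ 0 := by
  induction i with
  | zero =>
    refine ⟨Finsupp.single 0 1, Finsupp.single 1 1, Finsupp.single 2 1, ?_, ?_, ?_, fun k hk => ?_,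
      coeff_powerSum_ne_zero.2 ⟨0, rfl⟩, coeff_powerSum_ne_zero.2 ⟨1, rfl⟩,
      coeff_powerSum_ne_zero.2 ⟨2, rfl⟩⟩
    · simp [Finsupp.single_left_inj]
    · simp [Finsupp.single_left_inj]
    · simp [Finsupp.single_left_inj]
    · rw [Finsupp.single_eq_of_ne (by omega), Finsupp.single_eq_of_ne (by omega),
        Finsupp.single_eq_of_ne (by omega)]
      exact ⟨rfl, rfl, rfl⟩
  | succ i ih =>
    obtain ⟨u, v, w, huv, huw, hvw, hk, hu, hv, hw⟩ := ih
    refine ⟨1 • u + 1 • v, 1 • u + 1 • w, 1 • v + 1 • w, ?_, ?_, ?_, fun k hk' => ?_,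
      coeff_dSymm_plethysm_ne_zero 2 hu hv huv one_ne_zero one_ne_zero rfl,
      coeff_dSymm_plethysm_ne_zero 2 hu hw huw one_ne_zero one_ne_zero rfl,
      coeff_dSymm_plethysm_ne_zero 2 hv hw hvw one_ne_zero one_ne_zero rfl⟩
    · simpa using hvw
    · rw [add_comm (1 • u)]
      simpa using huw
    · simpa using huv
    · simp [hk k hk']

theorem coeff_dTypical (i j : ℕ) (c : ℕ →₀ ℕ) :
    MvPowerSeries.coeff (p ^ j • c) (dTypical p i j).1 =
      MvPowerSeries.coeff c (plethysmPow (dSymm p) i).1 := by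
  rw [dTypical_eq, coeff_plethysm_powerSum (prime_pow_ne_zero p j)]

theorem hookHom_dTypical_ne_zero {x y : ℕ} (hx : ¬ (x ≤ 1 ∨ (p = 2 ∧ x ≤ 2))) (i j : ℕ) :
    hookHom x y (dTypical p i j) ≠ 0 := by
  obtain ⟨c, hc, hk⟩ : ∃ c, MvPowerSeries.coeff c (plethysmPow (dSymm p) i).1 ≠ 0 ∧
      ∀ k, x ≤ k → c k = 0 := by
    by_cases hp : p = 2
    · subst hp
      obtain ⟨u, _, _, _, _, _, hk, hu, _⟩ := exists_three_coeff_plethysmPow_dSymm i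
      exact ⟨u, hu, fun k hk' => (hk k (by omega)).1⟩
    · obtain ⟨u, _, _, hk, hu, _⟩ := exists_two_coeff_plethysmPow_dSymm p hp i
      exact ⟨u, hu, fun k hk' => (hk k (by omega)).1⟩
  refine hookHom_ne_zero (c := p ^ j • c) (by rwa [coeff_dTypical]) (s := Finset.range x)
    (Finset.card_range x).le fun k hk' => ?_
  rw [Finset.mem_range, not_lt] at hk'
  simp [hk k hk']

theorem topHom_dTypical_ne_zero (i j : ℕ) : topHom (dTypical p i j) ≠ 0 := fun h =>
  hookHom_dTypical_ne_zero p (x := 3) (y := 0) (by omega) i j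
    (hookHom_eq_zero.2 fun l _ => topHom_eq_zero.1 h l)

/-- The zeros of the homomorphism with coordinates `(x, y)` on the `d_{i,j}`, in terms of the
supports of the `d^{∘ i}`. -/
theorem hookHom_dTypical_eq_zero_iff {x y z : ℕ} (hz : IsLeast {n : ℕ | y < p ^ n} z)
    (hlow : ∀ c, MvPowerSeries.coeff c (plethysmPow (dSymm p) x).1 ≠ 0 → x < c.support.card)
    (hone : ∃ c, MvPowerSeries.coeff c (plethysmPow (dSymm p) x).1 ≠ 0 ∧ ∀ k, c k ≤ 1)
    (hfew : ∀ i < x, ∃ c, MvPowerSeries.coeff c (plethysmPow (dSymm p) i).1 ≠ 0 ∧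
      ∀ k, x ≤ k → c k = 0) (i j : ℕ) :
    hookHom x y (dTypical p i j) = 0 ↔ x ≤ i ∧ z ≤ j := by
  let w : PTypicalWitt p BoolSemiring := canonicalMap p BoolSemiring (hookHom x y)
  have hw : ∀ i j, w (dGen p i j) = hookHom x y (dTypical p i j) := fun _ _ => rfl
  -- A monomial of d_{x,z} has more than x variables, each with exponent at least p^z > y, so after
  -- sorting it leaves the hook.
  have hxz : w (dGen p x z) = 0 := by
    rw [hw, hookHom_eq_zero]
    intro l hl
    by_contra hne
    rw [dTypical_eq] at hne
    obtain ⟨c, hc⟩ := exists_eq_smul_of_coeff_plethysm_powerSum (prime_pow_ne_zero p z) hne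
    rw [hc, coeff_plethysm_powerSum (prime_pow_ne_zero p z)] at hne
    have h1 := hlow c hne
    have h2 : c.support ⊆ Finset.range x := fun k hk => by
      rw [Finset.mem_range]
      by_contra hk'
      have h3 := l.2 (not_lt.1 hk')
      have h4 : l.1 k = p ^ z * c k := by rw [hc]; rfl
      have h5 := Nat.le_mul_of_pos_right (p ^ z) (Nat.pos_of_ne_zero (Finsupp.mem_support_iff.1 hk))
      have h6 : y < p ^ z := hz.1
      omega
    have h3 := Finset.card_le_card h2
    rw [Finset.card_range] at h3
    omega
  rw [← hw]
  constructor
  · intro h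
    have hi : x ≤ i := by
      by_contra hi
      obtain ⟨c, hc, hk⟩ := hfew i (not_le.1 hi)
      rw [hw] at h
      refine hookHom_ne_zero (c := p ^ j • c) (by rwa [coeff_dTypical]) (s := Finset.range x)
        (Finset.card_range x).le (fun k hk' => ?_) h
      rw [Finset.mem_range, not_lt] at hk'
      simp [hk k hk']
    refine ⟨hi, ?_⟩
    by_contra hj
    -- With d_{x,z} killed, a zero at (i, j) with j < z forces one at (x, j). There a monomial with
    -- exponents at most 1 becomes one with exponents at most p^j ≤ y, which survives.
    have h1 := map_dGen_eq_zero_inf w hi (not_le.1 hj).le hxz h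
    rw [hw] at h1
    obtain ⟨c, hc, hk⟩ := hone
    refine hookHom_ne_zero (c := p ^ j • c) (by rwa [coeff_dTypical]) (s := ∅)
      (Nat.zero_le _) (fun k _ => ?_) h1
    have h2 : p ^ j ≤ y := by
      by_contra h3
      exact hj (hz.2 (not_le.1 h3))
    exact (mul_le_of_le_one_right (Nat.zero_le _) (hk k)).trans h2
  · rintro ⟨h1, h2⟩
    exact map_dGen_eq_zero_mono w h1 h2 hxz

end Support

/-! ### The cases x ≤ 1, and x = 2 with p = 2. -/

theorem one_lt_card_support_of_ne_single {c : ℕ →₀ ℕ} {n : ℕ} (hdeg : c.degree = n)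
    (hc : ∀ k, c ≠ Finsupp.single k n) : 1 < c.support.card := by
  by_contra h
  obtain ⟨k, b, rfl⟩ := Finsupp.card_support_le_one'.1 (not_lt.1 h)
  rw [Finsupp.degree_single] at hdeg
  exact hc k (by rw [hdeg])

theorem apply_eq_one_of_degree_eq_two {c : ℕ →₀ ℕ} (hdeg : c.degree = 2)
    (hc : ∀ k, c ≠ Finsupp.single k 2) {k : ℕ} (hk : k ∈ c.support) : c k = 1 := by
  classical
  obtain ⟨m, hm, hmk⟩ := Finset.exists_mem_ne (one_lt_card_support_of_ne_single hdeg hc) k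
  have h1 : ∑ i ∈ {k, m}, c i ≤ c.degree := by
    rw [Finsupp.degree_apply]
    refine Finset.sum_le_sum_of_subset fun i hi => ?_
    rcases Finset.mem_insert.1 hi with rfl | hi
    · exact hk
    · rwa [Finset.mem_singleton.1 hi]
  rw [Finset.sum_pair hmk.symm, hdeg] at h1
  rw [Finsupp.mem_support_iff] at hk hm
  omega

/-- For p = 2, d is the elementary symmetric function e_2. Multiplicity one means that distinct
variables in a plethysm with d on the right stand for distinct monomials. -/
theorem coeff_dSymm_two_le (c : ℕ →₀ ℕ) : MvPowerSeries.coeff c (dSymm 2).1 ≤ 1 := by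
  classical
  by_cases h0 : MvPowerSeries.coeff c (dSymm 2).1 = 0
  · omega
  have hdeg := ((coeff_dSymm_ne_zero 2).1 h0).1
  have h := coeff_powerSum_one_pow_eq 2 c
  suffices MvPowerSeries.coeff c (powerSum 1 ^ 2 : SymmFunc).1 ≤ 2 by omega
  rw [pow_two]
  change MvPowerSeries.coeff c ((powerSum 1).1 * (powerSum 1).1) ≤ 2
  rw [MvPowerSeries.coeff_mul]
  simp only [coeff_powerSum, mul_ite, mul_one, mul_zero, ← ite_and]
  rw [← Finset.sum_filter, ← Finset.card_eq_sum_ones]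
  calc _ ≤ (c.support.image fun i => (Finsupp.single i 1, c - Finsupp.single i 1)).card := by
        refine Finset.card_le_card ?_
        rintro ⟨a, b⟩ hab
        rw [Finset.mem_filter, Finset.HasAntidiagonal.mem_antidiagonal] at hab
        obtain ⟨hab, -, i, rfl⟩ := hab
        rw [Finset.mem_image]
        refine ⟨i, ?_, ?_⟩
        · rw [Finsupp.mem_support_iff, ← hab]
          simp
        · rw [← hab]
          simp
    _ ≤ c.support.card := Finset.card_image_le
    _ ≤ c.degree := card_support_le_degree c
    _ = 2 := hdeg

/-- A monomial of e_2 ∘ e_2 is a product of two different monomials of e_2, but two variables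
support only one such monomial. -/
theorem two_lt_card_support_of_coeff {c : ℕ →₀ ℕ}
    (hc : MvPowerSeries.coeff c (plethysmPow (dSymm 2) 2).1 ≠ 0) : 2 < c.support.card := by
  classical
  change MvPowerSeries.coeff c (plethysm (dSymm 2) (plethysmPow (dSymm 2) 1)).1 ≠ 0 at hc
  rw [plethysmPow_one] at hc
  obtain ⟨α, ⟨h1, h2⟩, h3⟩ := coeff_plethysm_ne_zero.1 hc
  obtain ⟨hdeg, hns⟩ := (coeff_dSymm_ne_zero 2).1 h3
  have hcard := one_lt_card_support_of_ne_single hdeg hns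
  rw [Finsupp.mapDomain_support_of_injective enum.injective,
    Finset.card_image_of_injective _ enum.injective, Finset.one_lt_card] at hcard
  obtain ⟨q, hq, r, hr, hqr⟩ := hcard
  have hle : ∀ q ∈ α.support, q.2 = 0 ∧ q.1.degree = 2 ∧ (∀ k, q.1 ≠ Finsupp.single k 2) ∧
      q.1.support ⊆ c.support := fun q hq => by
    have h4 := h1 q hq
    have h5 := coeff_dSymm_two_le q.1
    obtain ⟨h6, h7⟩ := (coeff_dSymm_ne_zero 2).1 (Nat.ne_of_gt (Nat.zero_lt_of_lt h4))
    refine ⟨by omega, h6, h7, fun k hk => ?_⟩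
    have h8 : α q • q.1 ≤ α.sum (fun q m => m • q.1) :=
      Finset.single_le_sum (f := fun q => α q • q.1) (fun _ _ => zero_le) hq
    rw [h2] at h8
    have h9 : α q * q.1 k ≤ c k := h8 k
    rw [Finsupp.mem_support_iff] at hk hq ⊢
    have := Nat.mul_pos (Nat.pos_of_ne_zero hq) (Nat.pos_of_ne_zero hk)
    omega
  obtain ⟨hq1, hq2, hq3, hq4⟩ := hle q hq
  obtain ⟨hr1, hr2, hr3, hr4⟩ := hle r hr
  by_contra hlt
  have hq5 : q.1.support = c.support := Finset.eq_of_subset_of_card_le hq4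
    ((not_lt.1 hlt).trans (one_lt_card_support_of_ne_single hq2 hq3))
  have hr5 : r.1.support = c.support := Finset.eq_of_subset_of_card_le hr4
    ((not_lt.1 hlt).trans (one_lt_card_support_of_ne_single hr2 hr3))
  refine hqr (Prod.ext (Finsupp.ext fun k => ?_) (hq1.trans hr1.symm))
  by_cases hk : k ∈ c.support
  · rw [apply_eq_one_of_degree_eq_two hq2 hq3 (hq5 ▸ hk),
      apply_eq_one_of_degree_eq_two hr2 hr3 (hr5 ▸ hk)]
  · rw [Finsupp.notMem_support_iff.1 (hq5 ▸ hk), Finsupp.notMem_support_iff.1 (hr5 ▸ hk)]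

theorem coeff_rect_dSymm_ne_zero (p : ℕ) [Fact p.Prime] :
    MvPowerSeries.coeff (rect p 1).1 (plethysmPow (dSymm p) 1).1 ≠ 0 := by
  rw [plethysmPow_one, coeff_dSymm_ne_zero]
  have hp := (Fact.out : p.Prime).two_le
  refine ⟨by simp [rect], fun k hk => ?_⟩
  have h := congrArg (fun c => c k) hk
  simp only [rect_apply, Finsupp.single_eq_same] at h
  split_ifs at h <;> omega

theorem hookHom_dTypical_eq_zero {p : ℕ} [Fact p.Prime] {x y z : ℕ}
    (hx : x ≤ 1 ∨ (p = 2 ∧ x ≤ 2)) (hz : IsLeast {n : ℕ | y < p ^ n} z) (i j : ℕ) :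
    hookHom x y (dTypical p i j) = 0 ↔ x ≤ i ∧ z ≤ j := by
  have hzero : MvPowerSeries.coeff (Finsupp.single 0 1) (plethysmPow (dSymm p) 0).1 ≠ 0 :=
    coeff_powerSum_ne_zero.2 ⟨0, rfl⟩
  have hsingle : ∀ k, Finsupp.single 0 1 k ≤ 1 := fun k => by
    rw [Finsupp.single_apply]
    split_ifs <;> omega
  have hsingle' : ∀ k, 1 ≤ k → (Finsupp.single 0 1 : ℕ →₀ ℕ) k = 0 := fun k hk =>
    Finsupp.single_eq_of_ne (by omega)
  have hrect : ∀ a k, (rect a 1).1 k ≤ 1 := fun a k => by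
    rw [rect_apply]
    split_ifs <;> omega
  obtain rfl | rfl | ⟨rfl, rfl⟩ : x = 0 ∨ x = 1 ∨ (p = 2 ∧ x = 2) := by omega
  · refine hookHom_dTypical_eq_zero_iff p hz (fun c hc => ?_) ⟨_, hzero, hsingle⟩
      (fun i hi => absurd hi (Nat.not_lt_zero i)) i j
    obtain ⟨k, rfl⟩ := coeff_powerSum_ne_zero.1 hc
    rw [Finsupp.support_single k one_ne_zero]
    simp
  · refine hookHom_dTypical_eq_zero_iff p hz (fun c hc => ?_)
      ⟨_, coeff_rect_dSymm_ne_zero p, hrect p⟩ (fun i hi => ?_) i j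
    · rw [plethysmPow_one, coeff_dSymm_ne_zero] at hc
      exact one_lt_card_support_of_ne_single hc.1 hc.2
    · obtain rfl : i = 0 := by omega
      exact ⟨_, hzero, hsingle'⟩
  · refine hookHom_dTypical_eq_zero_iff 2 hz (fun c hc => two_lt_card_support_of_coeff hc)
      ?_ (fun i hi => ?_) i j
    -- The squarefree monomial of d ∘ d is x_0 x_1 · x_2 x_3; the block swap carries x_0 x_1 to x_2
    -- x_3.
    · have hu := coeff_rect_dSymm_ne_zero 2
      have hv := hu
      rw [← (plethysmPow (dSymm 2) 1).2.1 (blockSwap 0 2)] at hv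
      have hv' : ∀ k, (rect 2 1).1.mapDomain (blockSwap 0 2) k =
          if k < 2 then 0 else if k < 4 then 1 else 0 := fun k => by
        have hs : (blockSwap 0 2).symm k = if k < 0 then k else if k < 0 + 2 then k + 2 else
          if k < 0 + 2 * 2 then k - 2 else k := rfl
        rw [mapDomain_perm_apply', rect_apply, hs]
        grind
      refine ⟨_, coeff_dSymm_plethysm_ne_zero 2 hu hv (fun h => ?_) one_ne_zero one_ne_zero rfl,
        fun k => ?_⟩
      · have h0 := congrArg (fun c => c 0) h
        simp only [hv', rect_apply] at h0
        simp at h0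
      · rw [one_smul, one_smul, Finsupp.add_apply, hv', rect_apply]
        grind
    · obtain rfl | rfl : i = 0 ∨ i = 1 := by omega
      · exact ⟨_, hzero, fun k hk => hsingle' k (by omega)⟩
      · refine ⟨_, coeff_rect_dSymm_ne_zero 2, fun k hk => ?_⟩
        rw [rect_apply, if_neg (by omega)]

/-! The bijections. -/

section Bijections

variable (p : ℕ) [Fact p.Prime]

/-- The homomorphism `Λ_{ℕ,(p)} → B` with given coordinates. -/
noncomputable def pTypicalWittOfCoord : WithTop (ℕ × ℕ) → PTypicalWitt p BoolSemiring
  -- Taking the image of `topHom` as the point ∞ makes the final clause of the theorem hold by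
  -- definition.
  | ⊤ => canonicalMap p BoolSemiring topHom
  | ((x, y) : ℕ × ℕ) => (exists_pTypicalWitt p x y).choose

theorem pTypicalWittOfCoord_coe (x y i j : ℕ) :
    pTypicalWittOfCoord p ((x, y) : ℕ × ℕ) (dGen p i j) = 0 ↔ x ≤ i ∧ y ≤ j :=
  (exists_pTypicalWitt p x y).choose_spec i j

theorem pTypicalWittOfCoord_top (i j : ℕ) : pTypicalWittOfCoord p ⊤ (dGen p i j) ≠ 0 :=
  topHom_dTypical_ne_zero p i j

theorem pTypicalWittOfCoord_bijective : Function.Bijective (pTypicalWittOfCoord p) := by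
  have htop : ∀ x y, pTypicalWittOfCoord p ((x, y) : ℕ × ℕ) ≠ pTypicalWittOfCoord p ⊤ :=
    fun x y h => by
      have h1 := (pTypicalWittOfCoord_coe p x y x y).2 ⟨le_rfl, le_rfl⟩
      rw [h] at h1
      exact pTypicalWittOfCoord_top p x y h1
  constructor
  · intro u v h
    induction u with
    | top => induction v with
      | top => rfl
      | coe v => exact absurd h.symm (htop _ _)
    | coe u => induction v with
      | top => exact absurd h (htop _ _)
      | coe v =>
        obtain ⟨x, y⟩ := u
        obtain ⟨x', y'⟩ := v
        have h1 := pTypicalWittOfCoord_coe p x y x y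
        rw [h, pTypicalWittOfCoord_coe] at h1
        have h2 := pTypicalWittOfCoord_coe p x' y' x' y'
        rw [← h, pTypicalWittOfCoord_coe] at h2
        have hx : x = x' := by omega
        have hy : y = y' := by omega
        rw [hx, hy]
  · intro w
    rcases pTypicalWitt_classification w with h | ⟨x, y, h⟩
    · exact ⟨⊤, pTypicalWitt_ext fun i j => iff_of_false (pTypicalWittOfCoord_top p i j) (h i j)⟩
    · exact ⟨((x, y) : ℕ × ℕ), pTypicalWitt_ext fun i j => by
        rw [pTypicalWittOfCoord_coe, h]⟩

end Bijections

end BooleanWitt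

theorem mainTheorem9 (p : ℕ) [Fact p.Prime] :
    ∃ (Φ : WithTop (ℕ × ℕ) ≃ BooleanWitt.Witt BooleanWitt.BoolSemiring)
      (Ψ : WithTop (ℕ × ℕ) ≃ BooleanWitt.PTypicalWitt p BooleanWitt.BoolSemiring),
      -- the coordinates on `W(B)`
      (∀ (x y : ℕ) (l : BooleanWitt.Part),
        Φ ((x, y) : ℕ × ℕ) (BooleanWitt.monomialSymm l) = 0 ↔ y + 1 ≤ l.1 x) ∧
      (∀ l : BooleanWitt.Part, Φ ⊤ (BooleanWitt.monomialSymm l) = 1) ∧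
      -- the coordinates on `W_(p)(B)`
      (∀ x y i j : ℕ,
        Ψ ((x, y) : ℕ × ℕ) (BooleanWitt.dGen p i j) = 0 ↔ x ≤ i ∧ y ≤ j) ∧
      (∀ i j : ℕ, Ψ ⊤ (BooleanWitt.dGen p i j) = 1) ∧
      -- the canonical map in these coordinates
      (∀ x y z : ℕ, (x ≤ 1 ∨ (p = 2 ∧ x ≤ 2)) → IsLeast {n : ℕ | y < p ^ n} z →
        BooleanWitt.canonicalMap p BooleanWitt.BoolSemiring (Φ ((x, y) : ℕ × ℕ)) =
          Ψ ((x, z) : ℕ × ℕ)) ∧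
      (∀ x y : ℕ, ¬ (x ≤ 1 ∨ (p = 2 ∧ x ≤ 2)) →
        BooleanWitt.canonicalMap p BooleanWitt.BoolSemiring (Φ ((x, y) : ℕ × ℕ)) = Ψ ⊤) ∧
      BooleanWitt.canonicalMap p BooleanWitt.BoolSemiring (Φ ⊤) = Ψ ⊤ := by
  refine ⟨Equiv.ofBijective _ BooleanWitt.wittOfCoord_bijective,
    Equiv.ofBijective _ (BooleanWitt.pTypicalWittOfCoord_bijective p),
    fun x y l => BooleanWitt.hookHom_monomialSymm, fun l => BooleanWitt.topHom_monomialSymm,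
    BooleanWitt.pTypicalWittOfCoord_coe p,
    fun i j => BooleanWitt.BoolSemiring.ne_zero_iff.1 (BooleanWitt.pTypicalWittOfCoord_top p i j),
    fun x y z hx hz => ?_, fun x y hx => ?_, rfl⟩
  · exact BooleanWitt.pTypicalWitt_ext fun i j =>
      (BooleanWitt.hookHom_dTypical_eq_zero hx hz i j).trans
        (BooleanWitt.pTypicalWittOfCoord_coe p x z i j).symm
  · exact BooleanWitt.pTypicalWitt_ext fun i j =>
      iff_of_false (BooleanWitt.hookHom_dTypical_ne_zero p hx i j)
        (BooleanWitt.pTypicalWittOfCoord_top p i j)
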